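/- **Setting.** There are $n$ arms, and in each round at most $k$ of them may be played, $1\le k<n$. Each arm has a state in $\mathbb Z\setminus\{0\}$, initially $1$. A played arm moves from $\tau<0$ to $\tau-1$ and from $\tau>0$ to $-1$; an arm that is not played moves from $\tau<0$ to $1$ and from $\tau>0$ to $\tau+1$. Arm $i$ has a non-decreasing mean payoff function $p_i:\mathbb Z\setminus\{0\}\to[0,1]$ that is constant on states $\ge\tau^{\max}$ (with $\tau^{\max}\ge1$ known) and constant on all states below some negative state. The functions $p_i$ are unknown. Playing arm $i$ at state $\tau$ pays an independent draw from a distribution on $[0,1]$ that depends only on $(i,\tau)$ and has mean $p_i(\tau)$; the payoff of each arm played is observed. Let $\mathrm{OPT}(T)$ be the optimal total expected payoff in $T$ rounds under full knowledge of the $p_i$, and let $\gamma_k=1-\frac{k^k}{e^kk!}$. Fix $\varepsilon\in(0,1)$ and $L=\lceil 1/\varepsilon\rceil$. **Planning algorithm**, run on payoffs $\hat p$. For $1\le u\le\tau^{\max}$, $-L\le l\le-1$ let $\hat q_i(u,l)=\hat p_i(u)+\sum_{\tau=l+1}^{-1}\hat p_i(\tau)$, and compute a maximizer $x$ of $\sum_{i,u,l}\hat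 q_i(u,l)x_{i,u,l}$ over all $x\ge0$ with $\sum_{i,u,l}(-l)x_{i,u,l}\le k$ and $\sum_{u,l}(u-l)x_{i,u,l}\le1$ for every $i$. Independently for each arm $i$, sample at most one pair $(u_i,l_i)$, with probability $(u_i-l_i)x_{i,u_i,l_i}$, and then a uniform offset $r_i\in\{0,\dots,u_i-l_i-1\}$. Each sampled arm has a virtual state $\nu_i$ running periodically through $1,2,\dots,u_i,-1,-2,\dots,l_i$, where $\nu_i(0)$ is reached from state $1$ after $r_i$ steps and $\nu_i$ makes one step per round. In its round $t=1,2,\dots$ the algorithm plays, among the sampled arms with $\nu_i(t)=u_i$ or $l_i<\nu_i(t)<0$, a set of at most $k$ arms maximizing $\sum_i\hat p_i(\nu_i(t))$. **Theorem.** There is an absolute constant $K>0$ such that for all $1\le k<n$, $\tau^{\max}\ge1$, $\varepsilon\in(0,1)$ and every known horizon $T\ge1$ there is a fixed exploration schedule of finitely many rounds with at most $k$ plays per round, sampling every arm at least once at each of the states $-L,\dots,-1,1,\dots,\tau^{\max}$, with the following property. Consider the algorithm that follows this schedule and then runs the planning algorithm on the empirical mean payoffs observed during the schedule (if the schedule is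 longer than $T$, it is cut off at $T$). For every instance as above, and for every measurable way of choosing the maximizers in the planning algorithm (such ways exist), its total expected payoff $R(T)$ over the first $T$ rounds satisfies $$(1-\varepsilon)\,\gamma_k\,\mathrm{OPT}(T)-R(T)\;\le\;K\left(n^{1/3}k^{2/3}\Big((\tau^{\max})^2+\tfrac1\varepsilon\Big)^{1/3}\ln^{1/3}\!\Big(\big(\tau^{\max}+\tfrac1\varepsilon\big)T\Big)\,T^{2/3}+k\,\tau^{\max}+n\right).$$ -/

import Mathlib

open MeasureTheory ProbabilityTheory

noncomputable section

namespace MLSD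

/-! ### States, schedules and the planning optimum -/

/-- The state space `ℤ \ {0}`, ordered as a subset of `ℤ`. -/
abbrev State : Type := {τ : ℤ // τ ≠ 0}

/-- The positive state `m + 1`. -/
def posState (m : ℕ) : State := ⟨(m : ℤ) + 1, by omega⟩

/-- The negative state `-(m + 1)`. -/
def negState (m : ℕ) : State := ⟨-((m : ℤ) + 1), by omega⟩

/-- One state transition of a single arm, which is played iff `a = true`. -/
def step (a : Bool) (τ : State) : State :=
  if a then
    if h : τ.1 < 0 then ⟨τ.1 - 1, by omega⟩ else negState 0
  else
    if h : τ.1 < 0 then posState 0 else ⟨τ.1 + 1, by omega⟩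

/-- State of every arm at the beginning of round `t` under the schedule `A` (`A t` is the set of
arms played in round `t`). Rounds are numbered `0, 1, 2, …`; every arm starts in state `1`. -/
def stateAt {n : ℕ} (A : ℕ → Finset (Fin n)) : ℕ → Fin n → State
  | 0 => fun _ => posState 0
  | t + 1 => fun i => step (decide (i ∈ A t)) (stateAt A t i)

/-- Mean payoff functions of an instance: values in `[0,1]`, monotone non-decreasing, constant
from the known upper saturation time `τmax` on, and constant below some negative state. -/
structure IsPayoff {n : ℕ} (τmax : ℕ) (p : Fin n → State → ℝ) : Prop where
  nonneg : ∀ i τ, 0 ≤ p i τ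
  le_one : ∀ i τ, p i τ ≤ 1
  mono : ∀ i, Monotone (p i)
  saturation_upper : ∀ i (τ σ : State), (τmax : ℤ) ≤ τ.1 → (τmax : ℤ) ≤ σ.1 → p i τ = p i σ
  saturation_lower : ∃ τmin : ℤ, τmin < 0 ∧
    ∀ i (τ σ : State), τ.1 ≤ τmin → σ.1 ≤ τmin → p i τ = p i σ

/-- Total mean payoff of the schedule `A` in the first `T` rounds. -/
def totalPayoff {n : ℕ} (p : Fin n → State → ℝ) (A : ℕ → Finset (Fin n)) (T : ℕ) : ℝ :=
  ∑ t ∈ Finset.range T, ∑ i ∈ A t, p i (stateAt A t i)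

/-- `OPT(T)`: the optimal total expected payoff in `T` rounds with at most `k` plays per round
and full knowledge of the mean payoffs. (States do not depend on realized payoffs, so
deterministic schedules suffice.) -/
def opt {n : ℕ} (k : ℕ) (p : Fin n → State → ℝ) (T : ℕ) : ℝ :=
  sSup {r : ℝ | ∃ A : ℕ → Finset (Fin n), (∀ t, (A t).card ≤ k) ∧ r = totalPayoff p A T}

/-- `γ_k = 1 - k^k / (e^k k!)`. -/
def gammaK (k : ℕ) : ℝ := 1 - (k : ℝ) ^ k / (Real.exp k * (k.factorial : ℝ))

/-! ### Recurrent intervals and the linear program -/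

/-- Recurrent intervals `I(u,l)` with `1 ≤ u ≤ τmax` and `-L ≤ l ≤ -1`; the pair `(a, b)` stands
for `u = a + 1`, `l = -(b + 1)`. -/
abbrev Interval (τmax L : ℕ) : Type := Fin τmax × Fin L

namespace Interval

variable {τmax L : ℕ}

/-- The largest state `u` of the interval. -/
def u (I : Interval τmax L) : State := posState I.1

/-- The smallest state `l` of the interval. -/
def l (I : Interval τmax L) : State := negState I.2

/-- The length `u - l` of the interval. -/
def length (I : Interval τmax L) : ℕ := (I.1 + 1) + (I.2 + 1)

/-- The number `-l` of plays in the interval. -/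
def plays (I : Interval τmax L) : ℕ := I.2 + 1

/-- The characteristic trajectory: the arm is played exactly in the states
`l + 1, …, -1` and `u`. -/
def beta (I : Interval τmax L) (τ : State) : Bool :=
  decide (τ = I.u ∨ (I.l.1 < τ.1 ∧ τ.1 < 0))

/-- The transition function of the interval. -/
def delta (I : Interval τmax L) (τ : State) : State := step (I.beta τ) τ

/-- The aggregated payoff `q(u,l) = p(u) + ∑_{τ = l+1}^{-1} p(τ)` of the interval. -/
def aggPayoff (I : Interval τmax L) (p : State → ℝ) : ℝ :=
  p I.u + ∑ j ∈ Finset.range I.2, p (negState j)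

end Interval

/-- Feasibility for the LP relaxation. -/
structure LPFeasible {n : ℕ} (k τmax L : ℕ) (x : Fin n → Interval τmax L → ℝ) : Prop where
  nonneg : ∀ i I, 0 ≤ x i I
  total : ∑ i, ∑ I : Interval τmax L, (I.plays : ℝ) * x i I ≤ k
  arm : ∀ i, ∑ I : Interval τmax L, (I.length : ℝ) * x i I ≤ 1

/-- Objective of the LP relaxation for the payoffs `p`. -/
def lpValue {n τmax L : ℕ} (p : Fin n → State → ℝ) (x : Fin n → Interval τmax L → ℝ) : ℝ :=
  ∑ i, ∑ I : Interval τmax L, I.aggPayoff (p i) * x i I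

/-- Optimal solutions of the LP relaxation for the payoffs `p`. -/
def LPOptimal {n : ℕ} (k τmax L : ℕ) (p : Fin n → State → ℝ)
    (x : Fin n → Interval τmax L → ℝ) : Prop :=
  LPFeasible k τmax L x ∧ ∀ y, LPFeasible k τmax L y → lpValue p y ≤ lpValue p x

/-! ### The planning algorithm -/

/-- The two choices that the planning algorithm leaves open, made measurably: which optimal
solution of the LP is computed, and which maximizing set of at most `k` candidates is played. -/
structure Choices (n k τmax L : ℕ) where
  /-- The optimal LP solution computed for given payoffs. -/
  solve : (Fin n → State → ℝ) → Fin n → Interval τmax L → ℝ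
  solve_optimal : ∀ p, LPOptimal k τmax L p (solve p)
  solve_measurable : Measurable solve
  /-- The set played for given values of the arms and a given candidate set. -/
  pick : (Fin n → ℝ) → Finset (Fin n) → Finset (Fin n)
  pick_subset : ∀ w C, pick w C ⊆ C
  pick_card : ∀ w C, (pick w C).card ≤ k
  pick_max : ∀ w C S, S ⊆ C → S.card ≤ k → ∑ i ∈ S, w i ≤ ∑ i ∈ pick w C, w i
  pick_measurable : ∀ C S, MeasurableSet {w | pick w C = S}

/-- Outcome of the offline phase: for every arm either no interval, or a recurrent interval `I`
with an offset `r ∈ {0, …, length I - 1}`. -/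
abbrev Seed (n τmax L : ℕ) : Type :=
  Fin n → Option ((I : Interval τmax L) × Fin I.length)

/-- Probability of an outcome of the offline phase for the LP solution `x`: independently over
arms, `I` is sampled with probability `length I * x i I` (no interval with the remaining
probability), and then the offset is uniform. -/
def seedProb {n τmax L : ℕ} (x : Fin n → Interval τmax L → ℝ) (s : Seed n τmax L) : ℝ :=
  ∏ i, match s i with
    | none => 1 - ∑ I : Interval τmax L, (I.length : ℝ) * x i I
    | some ⟨I, _⟩ => ((I.length : ℝ) * x i I) * (1 / (I.length : ℝ))

/-- Virtual state `ν_i(t)` of an arm with interval `I` and offset `r`: start in state `1`, make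
`r` transitions to reach `ν_i(0)`, and then one transition per round. -/
def virtualState {τmax L : ℕ} (I : Interval τmax L) (r t : ℕ) : State :=
  I.delta^[t] (I.delta^[r] (posState 0))

/-- The set `C_t` of candidate arms in the `t`-th round (`t = 1, 2, …`) of the algorithm. -/
def candidates {n τmax L : ℕ} (s : Seed n τmax L) (t : ℕ) : Finset (Fin n) :=
  Finset.univ.filter fun i =>
    (match s i with
      | none => false
      | some ⟨I, r⟩ => I.beta (virtualState I r t)) = true

/-- The payoff of every arm at its virtual state in the `t`-th round (`0` without interval). -/
def virtualPayoff {n τmax L : ℕ} (p : Fin n → State → ℝ) (s : Seed n τmax L) (t : ℕ)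
    (i : Fin n) : ℝ :=
  match s i with
  | none => 0
  | some ⟨I, r⟩ => p i (virtualState I r t)

/-- The set played by the planning algorithm, run on the payoffs `p`, in its `t`-th round
(`t = 1, 2, …`). -/
def planPlay {n k τmax L : ℕ} (c : Choices n k τmax L) (p : Fin n → State → ℝ)
    (s : Seed n τmax L) (t : ℕ) : Finset (Fin n) :=
  c.pick (virtualPayoff p s t) (candidates s t)

/-! ### Semi-bandit feedback and the Explore-then-Commit adaptation -/

/-- Noisy payoffs: `X t i τ` is the payoff obtained and observed if arm `i` is played in round `t`
at state `τ`. All draws are independent, take values in `[0,1]`, and have a distribution that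
depends only on the arm and the state and has mean `p i τ`. -/
structure IsRewardModel {n : ℕ} {Ω : Type*} [MeasurableSpace Ω] (μ : Measure Ω)
    (p : Fin n → State → ℝ) (X : ℕ → Fin n → State → Ω → ℝ) : Prop where
  measurable : ∀ t i τ, Measurable (X t i τ)
  mem_Icc : ∀ t i τ, ∀ᵐ ω ∂μ, X t i τ ω ∈ Set.Icc (0 : ℝ) 1
  indep : iIndepFun (fun j : ℕ × Fin n × State => X j.1 j.2.1 j.2.2) μ
  ident : ∀ t t' i τ, IdentDistrib (X t i τ) (X t' i τ) μ μ
  mean : ∀ t i τ, ∫ ω, X t i τ ω ∂μ = p i τ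

/-- An exploration phase: a fixed feasible schedule of `N` rounds in which every arm is sampled at
least once in each of the states `-L, …, -1, 1, …, τmax`. -/
structure Exploration (n k τmax L : ℕ) where
  /-- Number of exploration rounds. -/
  N : ℕ
  /-- The set of arms played in each exploration round. -/
  play : ℕ → Finset (Fin n)
  card_le : ∀ t < N, (play t).card ≤ k
  covers : ∀ (i : Fin n) (τ : State), -(L : ℤ) ≤ τ.1 → τ.1 ≤ τmax →
    ∃ t < N, i ∈ play t ∧ stateAt play t i = τ

/-- Exploration rounds in which arm `i` is played at state `τ`. -/
def Exploration.samples {n k τmax L : ℕ} (E : Exploration n k τmax L) (i : Fin n) (τ : State) :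
    Finset ℕ :=
  (Finset.range E.N).filter fun t => i ∈ E.play t ∧ stateAt E.play t i = τ

/-- Empirical mean payoffs after the exploration phase; `X t i τ` are the realized payoffs. -/
def Exploration.estimate {n k τmax L : ℕ} (E : Exploration n k τmax L)
    (X : ℕ → Fin n → State → ℝ) (i : Fin n) (τ : State) : ℝ :=
  (∑ t ∈ E.samples i τ, X t i τ) / ((E.samples i τ).card : ℝ)

/-- The set played in round `t` by the Explore-then-Commit algorithm: follow the exploration
schedule for `N` rounds, and then run the planning algorithm on the empirical means `phat`. -/
def etcPlay {n k τmax L : ℕ} (E : Exploration n k τmax L) (c : Choices n k τmax L)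
    (phat : Fin n → State → ℝ) (s : Seed n τmax L) (t : ℕ) : Finset (Fin n) :=
  if t < E.N then E.play t else planPlay c phat s (t - E.N + 1)

/-- Payoff collected by the Explore-then-Commit algorithm in the first `T` rounds, for realized
payoffs `X`, in expectation over the internal randomness of the algorithm. -/
def etcRealized {n k τmax L : ℕ} (E : Exploration n k τmax L) (c : Choices n k τmax L)
    (X : ℕ → Fin n → State → ℝ) (T : ℕ) : ℝ :=
  ∑ s : Seed n τmax L, seedProb (c.solve (E.estimate X)) s *
    ∑ t ∈ Finset.range T, ∑ i ∈ etcPlay E c (E.estimate X) s t,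
      X t i (stateAt (etcPlay E c (E.estimate X) s) t i)

/-- `R(T)`: total expected payoff of the Explore-then-Commit algorithm over `T` rounds. -/
def etcPayoff {n k τmax L : ℕ} {Ω : Type*} [MeasurableSpace Ω] (μ : Measure Ω)
    (X : ℕ → Fin n → State → Ω → ℝ) (E : Exploration n k τmax L) (c : Choices n k τmax L)
    (T : ℕ) : ℝ :=
  ∫ ω, etcRealized E c (fun t i τ => X t i τ ω) T ∂μ

/-- Approximate regret `(1 - ε) γ_k OPT(T) - R(T)` of the Explore-then-Commit algorithm. -/
def etcRegret {n k τmax L : ℕ} {Ω : Type*} [MeasurableSpace Ω] (μ : Measure Ω) (ε : ℝ)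
    (p : Fin n → State → ℝ) (X : ℕ → Fin n → State → Ω → ℝ)
    (E : Exploration n k τmax L) (c : Choices n k τmax L) (T : ℕ) : ℝ :=
  (1 - ε) * gammaK k * opt k p T - etcPayoff μ X E c T

end MLSD

end

/-!
The regret splits into the cost of exploring, the loss of the planning algorithm with exact payoffs,
and the loss caused by estimation errors.

*Planning with exact payoffs.* The linear program bounds the optimum: the trajectory of each arm is
cut into recurrent intervals, where runs of more than `L` consecutive plays are replaced by
multiples of the interval `I(1, -L)` at a loss of the factor `L / (L + 1) ≥ 1 - ε`
(`exists_interval_cover`, `mul_opt_le_lpValue`). Conversely, with a uniform offset every virtual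
state is uniform on its cycle, so in each round the candidates are independent over the arms, their
expected number is at most `k`, and their expected total value is the value of the linear program
(`sum_armWeight_mul`). Taking the best `k` of them retains the fraction `γ_k`
(`gammaK_mul_le_sum_maximal`). By integrating over the levels of the payoffs, this reduces to
`E min(k, S) ≥ γ_k E S` for a sum `S` of independent Bernoulli variables with `E S ≤ k`; replacing
them one by one by Poisson variables only increases the shortfall `E (k - S)⁺`, and the shortfall
of a Poisson variable is a convex function of the mean with value `k (1 - γ_k)` at the mean `k`.
Real states never fall below virtual states (`virtualState_le_stateAt`), because the exploration
schedule ends with `τmax` idle rounds, and the payoffs are monotone.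

*Estimation errors.* If every state is sampled `M` times, then an arm has an error above `δ` with
probability at most `2 (τmax + L) exp (-2 M δ²)` by Hoeffding's inequality. Instead of a union bound
over the arms, an arm with such an error is charged `1` per round, which adds up to `O(n)` over all
rounds for `M δ² ≥ log ((τmax + 1/ε) T)`; all other errors cost at most `k δ` per round
(`gammaK_mul_lpValue_le_of_accurate`). After the exploration phase, realized payoffs may be
replaced by their means, since all choices of the algorithm depend on the exploration payoffs only
(`integral_roundPayoff`).

*Exploration.* The arms are explored in groups of `k`; one block of `O(τmax² + L)` rounds visits all
states once (`exists_exploration`). The stated bound results from balancing the cost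
`n (τmax² + 1/ε) M` of exploration with the cost `k T δ` of estimation. The choices of the planning
algorithm can be made measurably because finitely many feasible points suffice to maximize all
objectives (`exists_finite_maximizers`).
-/

noncomputable section

namespace MLSD

/-! ### Poisson shortfalls and sums of independent Bernoulli variables -/

/-- The probability `P(Poi(x) < c)`. -/
def poissonBelow (c : ℕ) (x : ℝ) : ℝ :=
  Real.exp (-x) * ∑ j ∈ Finset.range c, x ^ j / (j.factorial : ℝ)

/-- The expected shortfall `E (c - Poi(x))⁺`, written as `∑_{j ≤ c} P(Poi(x) < j)`. -/
def poissonShortfall (c : ℕ) (x : ℝ) : ℝ :=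
  ∑ j ∈ Finset.range c, poissonBelow (j + 1) x

lemma poissonBelow_succ (c : ℕ) (x : ℝ) :
    poissonBelow (c + 1) x
      = poissonBelow c x + Real.exp (-x) * (x ^ c / (c.factorial : ℝ)) := by
  simp [poissonBelow, Finset.sum_range_succ, mul_add]

lemma poissonShortfall_succ (c : ℕ) (x : ℝ) :
    poissonShortfall (c + 1) x = poissonShortfall c x + poissonBelow (c + 1) x := by
  simp [poissonShortfall, Finset.sum_range_succ]

lemma poissonShortfall_zero_right (c : ℕ) : poissonShortfall c 0 = c := by
  induction c with
  | zero => simp [poissonShortfall]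
  | succ c ih =>
    rw [poissonShortfall_succ, ih]
    simp [poissonBelow, Finset.sum_range_succ']

lemma hasDerivAt_poissonBelow (c : ℕ) (x : ℝ) :
    HasDerivAt (poissonBelow (c + 1)) (-(Real.exp (-x) * (x ^ c / (c.factorial : ℝ)))) x := by
  have hexp : HasDerivAt (fun y : ℝ => Real.exp (-y)) (-Real.exp (-x)) x := by
    simpa using (hasDerivAt_neg x).exp
  induction c with
  | zero =>
    have : poissonBelow (0 + 1) = fun y : ℝ => Real.exp (-y) := by
      funext y; simp [poissonBelow]
    rw [this]; simpa using hexp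
  | succ c ih =>
    have : poissonBelow (c + 1 + 1) = fun y => poissonBelow (c + 1) y
        + Real.exp (-y) * (y ^ (c + 1) / ((c + 1).factorial : ℝ)) := by
      funext y; exact poissonBelow_succ _ _
    rw [this]
    have h := ih.add (hexp.mul ((hasDerivAt_pow (c + 1) x).div_const ((c + 1).factorial : ℝ)))
    refine h.congr_deriv ?_
    have hc : (c.factorial : ℝ) ≠ 0 := by positivity
    rw [Nat.factorial_succ]
    push_cast
    have : (c : ℝ) + 1 ≠ 0 := by positivity
    field_simp
    ring

lemma hasDerivAt_poissonShortfall (c : ℕ) (x : ℝ) :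
    HasDerivAt (poissonShortfall c) (-poissonBelow c x) x := by
  induction c with
  | zero =>
    have : poissonShortfall 0 = fun _ => 0 := by funext y; simp [poissonShortfall]
    rw [this]; simpa [poissonBelow] using hasDerivAt_const x (0 : ℝ)
  | succ c ih =>
    have : poissonShortfall (c + 1) = fun y => poissonShortfall c y + poissonBelow (c + 1) y := by
      funext y; exact poissonShortfall_succ _ _
    rw [this]
    refine (ih.add (hasDerivAt_poissonBelow c x)).congr_deriv ?_
    rw [poissonBelow_succ]; ring

lemma antitoneOn_poissonBelow (c : ℕ) : AntitoneOn (poissonBelow c) (Set.Ici 0) := by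
  cases c with
  | zero => intro x _ y _ _; simp [poissonBelow]
  | succ c =>
    refine antitoneOn_of_deriv_nonpos (convex_Ici 0)
      (fun x _ => (hasDerivAt_poissonBelow c x).continuousAt.continuousWithinAt)
      (fun x _ => (hasDerivAt_poissonBelow c x).differentiableAt.differentiableWithinAt) ?_
    intro x hx
    rw [interior_Ici, Set.mem_Ioi] at hx
    rw [(hasDerivAt_poissonBelow c x).deriv]
    have : 0 ≤ Real.exp (-x) * (x ^ c / (c.factorial : ℝ)) := by positivity
    linarith

lemma convexOn_poissonShortfall (c : ℕ) : ConvexOn ℝ (Set.Ici 0) (poissonShortfall c) := by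
  refine MonotoneOn.convexOn_of_deriv (convex_Ici 0)
    (fun x _ => (hasDerivAt_poissonShortfall c x).continuousAt.continuousWithinAt)
    (fun x _ => (hasDerivAt_poissonShortfall c x).differentiableAt.differentiableWithinAt) ?_
  rw [interior_Ici]
  intro x hx y hy hxy
  rw [(hasDerivAt_poissonShortfall c x).deriv, (hasDerivAt_poissonShortfall c y).deriv]
  exact neg_le_neg (antitoneOn_poissonBelow c (Set.mem_Ici.2 (le_of_lt hx))
    (Set.mem_Ici.2 (le_of_lt hy)) hxy)

/-- Replacing a Bernoulli variable of mean `q` by a Poisson variable of the same mean increases the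
expected shortfall: this is the tangent-line inequality for the convex function
`poissonShortfall (c + 1)`, whose derivative is a difference of two shortfalls. -/
lemma bernoulli_add_poisson_le (c : ℕ) {x q : ℝ} (hx : 0 ≤ x) (hq : 0 ≤ q) :
    (1 - q) * poissonShortfall (c + 1) x + q * poissonShortfall c x
      ≤ poissonShortfall (c + 1) (x + q) := by
  rcases hq.eq_or_lt with rfl | hq
  · simp
  have h := (convexOn_poissonShortfall (c + 1)).le_slope_of_hasDerivAt (Set.mem_Ici.2 hx)
    (Set.mem_Ici.2 (by linarith : (0 : ℝ) ≤ x + q)) (by linarith)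
    (hasDerivAt_poissonShortfall (c + 1) x)
  rw [slope_def_field, le_div_iff₀ (by linarith)] at h
  have := poissonShortfall_succ c x
  nlinarith

lemma poissonShortfall_succ_eq (c : ℕ) (x : ℝ) :
    poissonShortfall (c + 1) x = (c + 1 - x) * poissonBelow (c + 1) x
      + Real.exp (-x) * (x ^ (c + 1) / (c.factorial : ℝ)) := by
  induction c with
  | zero => simp [poissonShortfall, poissonBelow]; ring
  | succ c ih =>
    rw [poissonShortfall_succ, ih, poissonBelow_succ (c + 1)]
    have hc : (c.factorial : ℝ) ≠ 0 := by positivity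
    rw [Nat.factorial_succ]
    push_cast
    have : (c : ℝ) + 1 ≠ 0 := by positivity
    field_simp
    ring

lemma poissonShortfall_self {k : ℕ} (hk : 1 ≤ k) :
    poissonShortfall k k = k * (1 - gammaK k) := by
  obtain ⟨c, rfl⟩ : ∃ c, k = c + 1 := ⟨k - 1, by omega⟩
  have h := poissonShortfall_succ_eq c ((c + 1 : ℕ) : ℝ)
  rw [h, gammaK, Nat.factorial_succ, Real.exp_neg]
  have hc : (c.factorial : ℝ) ≠ 0 := by positivity
  push_cast
  have : (c : ℝ) + 1 ≠ 0 := by positivity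
  field_simp
  ring

lemma gammaK_le_one (k : ℕ) : gammaK k ≤ 1 := by
  have : (0 : ℝ) ≤ (k : ℝ) ^ k / (Real.exp k * (k.factorial : ℝ)) := by positivity
  unfold gammaK; linarith

lemma gammaK_nonneg (k : ℕ) : 0 ≤ gammaK k := by
  unfold gammaK
  rw [sub_nonneg, div_le_one (by positivity)]
  have := Real.pow_div_factorial_le_exp (k : ℝ) (by positivity) k
  rwa [div_le_iff₀ (by positivity)] at this

/-- The chord of the convex function `poissonShortfall k` over `[0, k]`. -/
lemma poissonShortfall_le {k : ℕ} (hk : 1 ≤ k) {m : ℝ} (hm : 0 ≤ m) (hmk : m ≤ k) :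
    poissonShortfall k m ≤ k - gammaK k * m := by
  have hk' : (0 : ℝ) < k := by exact_mod_cast hk
  have h0 : 0 ≤ 1 - m / (k : ℝ) := by rw [sub_nonneg, div_le_one hk']; exact hmk
  have h := (convexOn_poissonShortfall k).2 (Set.mem_Ici.2 le_rfl) (Set.mem_Ici.2 hk'.le) h0
    (by positivity : 0 ≤ m / (k : ℝ)) (by ring)
  simp only [smul_eq_mul, mul_zero, zero_add, poissonShortfall_zero_right,
    poissonShortfall_self hk] at h
  rw [div_mul_cancel₀ _ hk'.ne'] at h
  refine h.trans (le_of_eq ?_)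
  field_simp
  ring

section Independent

variable {α : Type*} [Fintype α]

/-- A product of probability weights is a probability weight. -/
lemma sum_prod_weights_eq_one {n : ℕ} (w : Fin n → α → ℝ) (hw : ∀ i, ∑ a, w i a = 1) :
    ∑ s : Fin n → α, ∏ i, w i (s i) = 1 := by
  classical
  rw [← Fintype.prod_sum]
  simp [hw]

/-- The expected shortfall of a sum of independent Bernoulli variables is at most that of a
Poisson variable with the same mean. -/
lemma sum_shortfall_le_poissonShortfall (n : ℕ) (w : Fin n → α → ℝ) (hw0 : ∀ i a, 0 ≤ w i a)
    (hw : ∀ i, ∑ a, w i a = 1) (B : Fin n → α → Bool) (c : ℕ) :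
    ∑ s : Fin n → α, (∏ i, w i (s i)) *
        ((c - ∑ i, (if B i (s i) then 1 else 0) : ℕ) : ℝ)
      ≤ poissonShortfall c (∑ i, ∑ a, w i a * (if B i a then 1 else 0)) := by
  induction n generalizing c with
  | zero => simp [poissonShortfall_zero_right]
  | succ n ih =>
    cases c with
    | zero => simp [poissonShortfall]
    | succ c =>
      have ih' := ih (fun i => w i.succ) (fun i => hw0 i.succ) (fun i => hw i.succ)
        (fun i => B i.succ)
      rw [← (Fin.consEquiv (fun _ : Fin (n + 1) => α)).sum_comp, Fintype.sum_prod_type]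
      simp only [Fin.consEquiv_apply, Fin.prod_univ_succ, Fin.sum_univ_succ, Fin.cons_zero,
        Fin.cons_succ]
      set m : ℝ := ∑ i : Fin n, ∑ a, w i.succ a * (if B i.succ a then 1 else 0) with hm
      set q : ℝ := ∑ a, w 0 a * (if B 0 a then 1 else 0) with hq
      have hm0 : 0 ≤ m := Finset.sum_nonneg fun i _ => Finset.sum_nonneg fun a _ =>
        mul_nonneg (hw0 _ _) (by split_ifs <;> norm_num)
      have hq0 : 0 ≤ q := Finset.sum_nonneg fun a _ =>
        mul_nonneg (hw0 _ _) (by split_ifs <;> norm_num)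
      rw [add_comm q m]
      refine le_trans ?_ (bernoulli_add_poisson_le c hm0 hq0)
      have key : ∀ a, ∑ s : Fin n → α, (w 0 a * ∏ i, w i.succ (s i)) *
          ((c + 1 - ((if B 0 a then 1 else 0) +
            ∑ i : Fin n, (if B i.succ (s i) then 1 else 0)) : ℕ) : ℝ)
          ≤ w 0 a * ((1 - if B 0 a then 1 else 0) * poissonShortfall (c + 1) m
            + (if B 0 a then 1 else 0) * poissonShortfall c m) := by
        intro a
        simp only [mul_assoc]
        rw [← Finset.mul_sum]
        refine mul_le_mul_of_nonneg_left ?_ (hw0 _ _)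
        by_cases hB : B 0 a
        · simp only [hB, if_true, sub_self, zero_mul, one_mul, zero_add]
          refine le_trans (le_of_eq ?_) (ih' c)
          refine Finset.sum_congr rfl fun s _ => ?_
          rw [show c + 1 - (1 + ∑ i : Fin n, (if B i.succ (s i) then 1 else 0))
            = c - ∑ i : Fin n, (if B i.succ (s i) then 1 else 0) by omega]
        · simp only [hB]
          refine le_trans (le_of_eq ?_) ((ih' (c + 1)).trans (le_of_eq ?_))
          · simp
          · simp [hm]
      refine (Finset.sum_le_sum fun a _ => key a).trans (le_of_eq ?_)
      have h1 : ∀ a, w 0 a * ((1 - if B 0 a then 1 else 0) * poissonShortfall (c + 1) m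
            + (if B 0 a then 1 else 0) * poissonShortfall c m)
          = w 0 a * poissonShortfall (c + 1) m + (w 0 a * if B 0 a then 1 else 0) *
            (poissonShortfall c m - poissonShortfall (c + 1) m) := by
        intro a; ring
      rw [Finset.sum_congr rfl fun a _ => h1 a, Finset.sum_add_distrib, ← Finset.sum_mul,
        ← Finset.sum_mul, hw 0, ← hq]
      ring

/-- The correlation gap of the `k`-uniform matroid: if independent events have total probability
`m ≤ k`, then the expected number of events that occur, truncated at `k`, is at least
`γ_k m`. -/
lemma gammaK_mul_le_sum_min {n k : ℕ} (hk : 1 ≤ k) (w : Fin n → α → ℝ)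
    (hw0 : ∀ i a, 0 ≤ w i a) (hw : ∀ i, ∑ a, w i a = 1) (B : Fin n → α → Bool)
    (hm : ∑ i, ∑ a, w i a * (if B i a then 1 else 0) ≤ k) :
    gammaK k * ∑ i, ∑ a, w i a * (if B i a then 1 else 0)
      ≤ ∑ s : Fin n → α, (∏ i, w i (s i)) *
        ((min k (∑ i, (if B i (s i) then 1 else 0)) : ℕ) : ℝ) := by
  have h1 := sum_shortfall_le_poissonShortfall n w hw0 hw B k
  have hm0 : 0 ≤ ∑ i, ∑ a, w i a * (if B i a then (1 : ℝ) else 0) :=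
    Finset.sum_nonneg fun i _ => Finset.sum_nonneg fun a _ =>
      mul_nonneg (hw0 _ _) (by split_ifs <;> norm_num)
  have h2 := poissonShortfall_le hk hm0 hm
  have h3 : ∑ s : Fin n → α, (∏ i, w i (s i)) *
        ((min k (∑ i, (if B i (s i) then 1 else 0)) : ℕ) : ℝ)
      = k - ∑ s : Fin n → α, (∏ i, w i (s i)) *
        ((k - ∑ i, (if B i (s i) then 1 else 0) : ℕ) : ℝ) := by
    rw [eq_sub_iff_add_eq, ← Finset.sum_add_distrib]
    have : ∀ s : Fin n → α, (∏ i, w i (s i)) *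
        ((min k (∑ i, (if B i (s i) then 1 else 0)) : ℕ) : ℝ) + (∏ i, w i (s i)) *
        ((k - ∑ i, (if B i (s i) then 1 else 0) : ℕ) : ℝ) = (∏ i, w i (s i)) * k := by
      intro s
      rw [← mul_add, ← Nat.cast_add]
      congr 2
      omega
    rw [Finset.sum_congr rfl fun s _ => this s, ← Finset.sum_mul, sum_prod_weights_eq_one w hw,
      one_mul]
  rw [h3]
  linarith

end Independent

/-! ### Virtual trajectories and the distribution of the seeds -/

namespace Interval

variable {τmax L : ℕ}

/-- The state of the trajectory `1, …, u, -1, …, l` after `m < length` steps from state `1`. -/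
def cycleState (I : Interval τmax L) (m : ℕ) : State :=
  if m ≤ I.1 then posState m else negState (m - I.1 - 1)

lemma cycleState_le (I : Interval τmax L) {m : ℕ} (h : m ≤ I.1) :
    I.cycleState m = posState m := by simp [cycleState, h]

lemma cycleState_add (I : Interval τmax L) (j : ℕ) :
    I.cycleState ((I.1 + 1) + j) = negState j := by
  have h : ¬ ((I.1 : ℕ) + 1 + j ≤ I.1) := by omega
  simp only [cycleState, h, if_false]
  congr 1
  omega

lemma length_pos (I : Interval τmax L) : 0 < I.length := by unfold length; omega

lemma beta_posState (I : Interval τmax L) (m : ℕ) : I.beta (posState m) = decide (m = I.1) := by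
  simp only [beta, u, l, posState, negState, decide_eq_decide, Subtype.mk.injEq]
  omega

lemma beta_negState (I : Interval τmax L) (m : ℕ) : I.beta (negState m) = decide (m < I.2) := by
  simp only [beta, u, l, posState, negState, decide_eq_decide, Subtype.mk.injEq]
  omega

lemma step_true_posState (m : ℕ) : step true (posState m) = negState 0 := by
  rw [step, if_pos rfl, dif_neg (show ¬ (posState m).1 < 0 by simp only [posState]; omega)]

lemma step_false_posState (m : ℕ) : step false (posState m) = posState (m + 1) := by
  rw [step, if_neg (by simp),
    dif_neg (show ¬ (posState m).1 < 0 by simp only [posState]; omega)]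
  ext
  simp [posState]

lemma step_true_negState (m : ℕ) : step true (negState m) = negState (m + 1) := by
  rw [step, if_pos rfl, dif_pos (show (negState m).1 < 0 by simp only [negState]; omega)]
  ext
  simp only [negState]
  push_cast
  ring

lemma step_false_negState (m : ℕ) : step false (negState m) = posState 0 := by
  rw [step, if_neg (by simp),
    dif_pos (show (negState m).1 < 0 by simp only [negState]; omega)]

lemma delta_cycleState (I : Interval τmax L) {m : ℕ} (hm : m < I.length) :
    I.delta (I.cycleState m) = I.cycleState ((m + 1) % I.length) := by
  have hlen : I.length = (I.1 + 1) + (I.2 + 1) := rfl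
  rcases lt_or_ge m (I.1 + 1) with h | h
  · rw [Nat.mod_eq_of_lt (by omega), cycleState_le I (by omega), delta, beta_posState]
    rcases eq_or_ne m I.1 with h' | h'
    · rw [decide_eq_true h', step_true_posState, h']
      exact (cycleState_add I 0).symm
    · rw [decide_eq_false h', step_false_posState, cycleState_le I (by omega)]
  · obtain ⟨j, rfl⟩ := Nat.exists_eq_add_of_le h
    rw [cycleState_add, delta, beta_negState]
    rcases lt_or_ge j I.2 with h' | h'
    · rw [decide_eq_true h', step_true_negState, Nat.mod_eq_of_lt (by omega), add_assoc (_ + 1),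
        cycleState_add]
    · rw [decide_eq_false (by omega), step_false_negState,
        show (I.1 : ℕ) + 1 + j + 1 = I.length by omega, Nat.mod_self, cycleState_le I (by omega)]

lemma iterate_delta (I : Interval τmax L) (m : ℕ) :
    I.delta^[m] (posState 0) = I.cycleState (m % I.length) := by
  induction m with
  | zero => simp [cycleState_le]
  | succ m ih =>
    rw [Function.iterate_succ_apply', ih, delta_cycleState I (Nat.mod_lt _ I.length_pos),
      Nat.mod_add_mod]

lemma virtualState_eq (I : Interval τmax L) (r t : ℕ) :
    virtualState I r t = I.cycleState ((r + t) % I.length) := by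
  rw [virtualState, ← Function.iterate_add_apply, iterate_delta, add_comm t r]

lemma virtualState_succ (I : Interval τmax L) (r t : ℕ) :
    virtualState I r (t + 1) = step (I.beta (virtualState I r t)) (virtualState I r t) := by
  rw [virtualState, Function.iterate_succ_apply']
  rfl

/-- The virtual state is at least `l`; it is never in the saturated range beyond `τmax`. -/
lemma virtualState_bounds (I : Interval τmax L) (r t : ℕ) :
    -(L : ℤ) ≤ (virtualState I r t).1 ∧ (virtualState I r t).1 ≤ τmax ∧
      (virtualState I r t).1 ≤ I.u.1 ∧ I.l.1 ≤ (virtualState I r t).1 := by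
  rw [virtualState_eq]
  have h := Nat.mod_lt (r + t) I.length_pos
  have hlen : I.length = (I.1 + 1) + (I.2 + 1) := rfl
  have h1 := I.1.2
  have h2 := I.2.2
  generalize (r + t) % I.length = m at h
  unfold cycleState u l
  split_ifs <;> simp only [posState, negState] <;> omega

/-- A periodic sequence has the same sum over all windows of one period. -/
lemma sum_range_add_of_periodic {f : ℕ → ℝ} {c : ℕ} (hf : Function.Periodic f c) (t : ℕ) :
    ∑ r ∈ Finset.range c, f (r + t) = ∑ r ∈ Finset.range c, f r := by
  induction t with
  | zero => simp
  | succ t ih =>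
    rw [← ih]
    have h1 := Finset.sum_range_succ (fun r => f (r + t)) c
    have h2 := Finset.sum_range_succ' (fun r => f (r + t)) c
    have h3 : f (c + t) = f (0 + t) := by rw [add_comm c t, hf, zero_add]
    rw [h1, h3] at h2
    have := add_right_cancel h2
    rw [this]
    refine Finset.sum_congr rfl fun r _ => ?_
    congr 1
    omega

/-- With a uniform offset, the virtual state is uniform on the cycle, so the payoffs at the
states where the arm is a candidate add up to the aggregated payoff, in every round. -/
lemma sum_virtualState (I : Interval τmax L) (g : State → ℝ) (t : ℕ) :
    ∑ r : Fin I.length, (if I.beta (virtualState I r t) then g (virtualState I r t) else 0)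
      = I.aggPayoff g := by
  have h1 : ∀ r : Fin I.length,
      (if I.beta (virtualState I r t) then g (virtualState I r t) else 0)
        = (fun m => if I.beta (I.cycleState (m % I.length)) then
            g (I.cycleState (m % I.length)) else 0) (r + t) := by
    intro r; simp only [virtualState_eq]
  rw [Finset.sum_congr rfl fun r _ => h1 r,
    Fin.sum_univ_eq_sum_range (fun r => (fun m => if I.beta (I.cycleState (m % I.length)) then
            g (I.cycleState (m % I.length)) else 0) (r + t)),
    sum_range_add_of_periodic (f := fun m => if I.beta (I.cycleState (m % I.length)) then
            g (I.cycleState (m % I.length)) else 0) (c := I.length) (by intro m; simp)]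
  have h2 : ∀ m ∈ Finset.range I.length, (if I.beta (I.cycleState (m % I.length)) then
            g (I.cycleState (m % I.length)) else 0)
      = if I.beta (I.cycleState m) then g (I.cycleState m) else 0 := by
    intro m hm
    rw [Nat.mod_eq_of_lt (Finset.mem_range.1 hm)]
  rw [Finset.sum_congr rfl h2, show I.length = (I.1 + 1) + (I.2 + 1) from rfl,
    Finset.sum_range_add, Finset.sum_range_succ, Finset.sum_range_succ _ (I.2 : ℕ)]
  have h3 : ∑ m ∈ Finset.range I.1,
      (if I.beta (I.cycleState m) then g (I.cycleState m) else 0) = 0 := by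
    refine Finset.sum_eq_zero fun m hm => ?_
    rw [Finset.mem_range] at hm
    rw [cycleState_le I hm.le, beta_posState, decide_eq_false hm.ne]
    simp
  rw [h3, cycleState_le I le_rfl, beta_posState]
  have h4 : ∀ j ∈ Finset.range I.2, (if I.beta (I.cycleState (I.1 + 1 + j)) then
      g (I.cycleState (I.1 + 1 + j)) else 0) = g (negState j) := by
    intro j hj
    rw [cycleState_add, beta_negState, decide_eq_true (Finset.mem_range.1 hj)]
    simp
  rw [Finset.sum_congr rfl h4, cycleState_add, beta_negState]
  simp [aggPayoff, u]

lemma aggPayoff_one (I : Interval τmax L) : I.aggPayoff (fun _ => 1) = I.plays := by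
  simp [aggPayoff, plays, add_comm]

end Interval

section Seeds

variable {n k τmax L : ℕ}

/-- The probability weight of a seed of the single arm `i`. -/
def armWeight (x : Fin n → Interval τmax L → ℝ) (i : Fin n)
    (o : Option ((I : Interval τmax L) × Fin I.length)) : ℝ :=
  match o with
  | none => 1 - ∑ I : Interval τmax L, (I.length : ℝ) * x i I
  | some ⟨I, _⟩ => ((I.length : ℝ) * x i I) * (1 / (I.length : ℝ))

/-- Whether an arm with the given seed is a candidate in round `t`. -/
def isCandidate (t : ℕ) (o : Option ((I : Interval τmax L) × Fin I.length)) : Bool :=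
  match o with
  | none => false
  | some ⟨I, r⟩ => I.beta (virtualState I r t)

/-- The value of `g` at the virtual state of an arm with the given seed in round `t`. -/
def seedValue (g : State → ℝ) (t : ℕ)
    (o : Option ((I : Interval τmax L) × Fin I.length)) : ℝ :=
  match o with
  | none => 0
  | some ⟨I, r⟩ => g (virtualState I r t)

lemma seedProb_eq (x : Fin n → Interval τmax L → ℝ) (s : Seed n τmax L) :
    seedProb x s = ∏ i, armWeight x i (s i) := rfl

lemma mem_candidates (s : Seed n τmax L) (t : ℕ) (i : Fin n) :
    i ∈ candidates s t ↔ isCandidate t (s i) = true := by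
  simp only [candidates, Finset.mem_filter, Finset.mem_univ, true_and]
  rfl

lemma virtualPayoff_eq (p : Fin n → State → ℝ) (s : Seed n τmax L) (t : ℕ) (i : Fin n) :
    virtualPayoff p s t i = seedValue (p i) t (s i) := rfl

lemma armWeight_some (x : Fin n → Interval τmax L → ℝ) (i : Fin n) (I : Interval τmax L)
    (r : Fin I.length) : armWeight x i (some ⟨I, r⟩) = x i I := by
  have : (I.length : ℝ) ≠ 0 := by exact_mod_cast I.length_pos.ne'
  simp only [armWeight]
  field_simp

lemma armWeight_nonneg {x : Fin n → Interval τmax L → ℝ} (hx : LPFeasible k τmax L x)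
    (i : Fin n) (o : Option ((I : Interval τmax L) × Fin I.length)) : 0 ≤ armWeight x i o := by
  rcases o with _ | ⟨I, r⟩
  · simpa [armWeight] using hx.arm i
  · rw [armWeight_some]; exact hx.nonneg i I

lemma sum_armWeight (x : Fin n → Interval τmax L → ℝ) (i : Fin n) :
    ∑ o, armWeight x i o = 1 := by
  rw [Fintype.sum_option, Fintype.sum_sigma]
  simp only [armWeight_some]
  simp [armWeight]

/-- In every round, arm `i` is a candidate at the states of the interval `I` with probability
`x i I` each. -/
lemma sum_armWeight_mul (x : Fin n → Interval τmax L → ℝ) (i : Fin n) (g : State → ℝ) (t : ℕ) :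
    ∑ o, armWeight x i o * (if isCandidate t o then seedValue g t o else 0)
      = ∑ I : Interval τmax L, I.aggPayoff g * x i I := by
  rw [Fintype.sum_option, Fintype.sum_sigma]
  have h : armWeight x i none *
      (if isCandidate t (none : Option ((I : Interval τmax L) × Fin I.length)) then
        seedValue g t (none : Option ((I : Interval τmax L) × Fin I.length)) else 0) = 0 := by
    simp [seedValue]
  rw [h, zero_add]
  refine Finset.sum_congr rfl fun I _ => ?_
  simp only [armWeight_some]
  rw [← Finset.mul_sum, mul_comm]
  congr 1
  exact I.sum_virtualState g t

lemma sum_seedProb (x : Fin n → Interval τmax L → ℝ) : ∑ s, seedProb x s = 1 :=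
  sum_prod_weights_eq_one _ (sum_armWeight x)

lemma seedProb_nonneg {x : Fin n → Interval τmax L → ℝ} (hx : LPFeasible k τmax L x)
    (s : Seed n τmax L) : 0 ≤ seedProb x s :=
  Finset.prod_nonneg fun i _ => armWeight_nonneg hx i _

end Seeds

/-! ### The planning algorithm against the linear program -/

section Planning

variable {α : Type*} [Fintype α]

lemma antitone_levelIndicator (v : ℝ) : Antitone fun θ : ℝ => if θ < v then (1 : ℝ) else 0 := by
  intro a b hab
  by_cases h : b < v
  · simp [h, lt_of_le_of_lt hab h]
  · simp only [h, if_false]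
    split_ifs <;> norm_num

lemma integral_levelIndicator {v : ℝ} (h0 : 0 ≤ v) (h1 : v ≤ 1) :
    ∫ θ in (0 : ℝ)..1, (if θ < v then (1 : ℝ) else 0) = v := by
  rw [← intervalIntegral.integral_add_adjacent_intervals (b := v)
    ((antitone_levelIndicator v).intervalIntegrable)
    ((antitone_levelIndicator v).intervalIntegrable)]
  have e1 : ∫ θ in (0 : ℝ)..v, (if θ < v then (1 : ℝ) else 0) = ∫ θ in (0 : ℝ)..v, (1 : ℝ) := by
    refine intervalIntegral.integral_congr_ae ?_
    have : ∀ᵐ θ : ℝ ∂volume, θ ≠ v := by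
      simp [ae_iff, measure_singleton]
    filter_upwards [this] with θ hθ hm
    rw [Set.uIoc_of_le h0] at hm
    simp [lt_of_le_of_ne hm.2 hθ]
  have e2 : ∫ θ in v..(1 : ℝ), (if θ < v then (1 : ℝ) else 0) = ∫ θ in v..(1 : ℝ), (0 : ℝ) := by
    refine intervalIntegral.integral_congr fun θ hm => ?_
    rw [Set.uIcc_of_le h1] at hm
    simp [hm.1]
  rw [e1, e2]
  simp

lemma intervalIntegrable_sum {ι : Type*} (S : Finset ι) {f : ι → ℝ → ℝ} {a b : ℝ}
    (h : ∀ i ∈ S, IntervalIntegrable (f i) volume a b) :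
    IntervalIntegrable (fun θ => ∑ i ∈ S, f i θ) volume a b := by
  have := IntervalIntegrable.sum S h
  simpa only [Finset.sum_fn] using this

/-- A set of at most `k` candidates with the largest total value contains, for every level
`θ ≥ 0`, as many candidates above this level as possible: otherwise adding or exchanging an
element would improve it. -/
lemma min_card_le_of_maximal {n k : ℕ} (v : Fin n → ℝ) (C P : Finset (Fin n)) (hPC : P ⊆ C)
    (hPk : P.card ≤ k)
    (hmax : ∀ S ⊆ C, S.card ≤ k → ∑ i ∈ S, v i ≤ ∑ i ∈ P, v i) {θ : ℝ} (hθ : 0 ≤ θ) :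
    min k (C.filter fun i => θ < v i).card ≤ (P.filter fun i => θ < v i).card := by
  by_contra! hlt
  rw [lt_min_iff] at hlt
  obtain ⟨j, hjC, hjP⟩ : ∃ j ∈ C.filter (fun i => θ < v i), j ∉ P.filter fun i => θ < v i :=
    Finset.exists_mem_notMem_of_card_lt_card hlt.2
  rw [Finset.mem_filter] at hjC
  have hj : j ∉ P := fun h => hjP (Finset.mem_filter.2 ⟨h, hjC.2⟩)
  rcases lt_or_ge P.card k with hk | hk
  · have h := hmax (insert j P) (Finset.insert_subset hjC.1 hPC)
      (by rw [Finset.card_insert_of_notMem hj]; omega)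
    rw [Finset.sum_insert hj] at h
    linarith [hjC.2]
  · obtain ⟨i, hi, hiv⟩ : ∃ i ∈ P, ¬ θ < v i := by
      by_contra! hall
      rw [Finset.filter_true_of_mem hall] at hlt
      omega
    have hj' : j ∉ P.erase i := fun h => hj (Finset.mem_of_mem_erase h)
    have h := hmax (insert j (P.erase i))
      (Finset.insert_subset hjC.1 ((Finset.erase_subset _ _).trans hPC))
      (by rw [Finset.card_insert_of_notMem hj', Finset.card_erase_of_mem hi]; omega)
    rw [Finset.sum_insert hj', ← Finset.add_sum_erase P v hi] at h
    linarith [hjC.2]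

/-- Selecting the best `k` of independent random candidates of expected number at most `k` gains
at least the fraction `γ_k` of their expected total value. The case of indicator values is
`gammaK_mul_le_sum_min`; the general case follows by integrating over all levels. -/
lemma gammaK_mul_le_sum_maximal {n k : ℕ} (hk : 1 ≤ k) (w : Fin n → α → ℝ)
    (hw0 : ∀ i a, 0 ≤ w i a) (hw : ∀ i, ∑ a, w i a = 1) (B : Fin n → α → Bool)
    (v : Fin n → α → ℝ) (hv0 : ∀ i a, B i a → 0 ≤ v i a) (hv1 : ∀ i a, B i a → v i a ≤ 1)
    (hm : ∑ i, ∑ a, w i a * (if B i a then 1 else 0) ≤ k)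
    (P : (Fin n → α) → Finset (Fin n)) (hPB : ∀ s, ∀ i ∈ P s, B i (s i))
    (hPk : ∀ s, (P s).card ≤ k)
    (hmax : ∀ s S, (∀ i ∈ S, B i (s i)) → S.card ≤ k →
      ∑ i ∈ S, v i (s i) ≤ ∑ i ∈ P s, v i (s i)) :
    gammaK k * ∑ i, ∑ a, w i a * (if B i a then v i a else 0)
      ≤ ∑ s : Fin n → α, (∏ i, w i (s i)) * ∑ i ∈ P s, v i (s i) := by
  have hlevel : ∀ θ : ℝ, 0 ≤ θ →
      gammaK k * ∑ i, ∑ a, (w i a * (if B i a then 1 else 0)) * (if θ < v i a then 1 else 0)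
        ≤ ∑ s : Fin n → α, (∏ i, w i (s i)) * ∑ i ∈ P s, (if θ < v i (s i) then 1 else 0) := by
    intro θ hθ
    have hB : ∀ i a, (w i a * (if B i a then 1 else 0)) * (if θ < v i a then 1 else 0)
        = w i a * (if (B i a && decide (θ < v i a)) then (1 : ℝ) else 0) := by
      intro i a
      by_cases h1 : B i a <;> by_cases h2 : θ < v i a <;> simp [h1, h2]
    simp only [hB]
    refine (gammaK_mul_le_sum_min hk w hw0 hw (fun i a => B i a && decide (θ < v i a)) ?_).trans ?_
    · refine le_trans (Finset.sum_le_sum fun i _ => Finset.sum_le_sum fun a _ => ?_) hm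
      refine mul_le_mul_of_nonneg_left ?_ (hw0 i a)
      by_cases h1 : B i a <;> by_cases h2 : θ < v i a <;> simp [h1, h2]
    · refine Finset.sum_le_sum fun s _ => mul_le_mul_of_nonneg_left ?_
        (Finset.prod_nonneg fun i _ => hw0 i _)
      have h := min_card_le_of_maximal (fun i => v i (s i))
        (Finset.univ.filter fun i => B i (s i)) (P s)
        (fun i hi => Finset.mem_filter.2 ⟨Finset.mem_univ _, hPB s i hi⟩) (hPk s)
        (fun S hS => hmax s S fun i hi => (Finset.mem_filter.1 (hS hi)).2) hθ
      rw [Finset.filter_filter] at h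
      simp only [Finset.sum_boole, Bool.and_eq_true, decide_eq_true_eq, Nat.cast_id]
      exact_mod_cast h
  have hint : ∀ u : ℝ, IntervalIntegrable (fun θ : ℝ => if θ < u then (1 : ℝ) else 0) volume 0 1 :=
    fun u => (antitone_levelIndicator u).intervalIntegrable
  have hI0 : ∀ i, IntervalIntegrable (fun θ : ℝ =>
      ∑ a, (w i a * (if B i a then 1 else 0)) * (if θ < v i a then 1 else 0)) volume 0 1 :=
    fun i => intervalIntegrable_sum _ fun a _ => (hint _).const_mul _
  have hI1 : IntervalIntegrable (fun θ : ℝ => gammaK k *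
      ∑ i, ∑ a, (w i a * (if B i a then 1 else 0)) * (if θ < v i a then 1 else 0)) volume 0 1 :=
    (intervalIntegrable_sum _ fun i _ => hI0 i).const_mul _
  have hI2 : ∀ s, IntervalIntegrable (fun θ : ℝ => (∏ i, w i (s i)) *
      ∑ i ∈ P s, (if θ < v i (s i) then (1 : ℝ) else 0)) volume 0 1 :=
    fun s => (intervalIntegrable_sum _ fun i _ => hint _).const_mul _
  have hmono := intervalIntegral.integral_mono_on (zero_le_one) hI1
    (intervalIntegrable_sum _ fun s _ => hI2 s) (fun θ hθ => hlevel θ hθ.1)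
  have e1 : ∫ θ in (0 : ℝ)..1, gammaK k *
      ∑ i, ∑ a, (w i a * (if B i a then 1 else 0)) * (if θ < v i a then 1 else 0)
      = gammaK k * ∑ i, ∑ a, w i a * (if B i a then v i a else 0) := by
    rw [intervalIntegral.integral_const_mul, intervalIntegral.integral_finsetSum
      fun i _ => hI0 i]
    congr 1
    refine Finset.sum_congr rfl fun i _ => ?_
    rw [intervalIntegral.integral_finsetSum fun a _ => (hint _).const_mul _]
    refine Finset.sum_congr rfl fun a _ => ?_
    rw [intervalIntegral.integral_const_mul]
    by_cases h : B i a
    · rw [integral_levelIndicator (hv0 i a h) (hv1 i a h)]; simp [h]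
    · simp [h]
  have e2 : ∫ θ in (0 : ℝ)..1, ∑ s : Fin n → α, (∏ i, w i (s i)) *
      ∑ i ∈ P s, (if θ < v i (s i) then (1 : ℝ) else 0)
      = ∑ s : Fin n → α, (∏ i, w i (s i)) * ∑ i ∈ P s, v i (s i) := by
    rw [intervalIntegral.integral_finsetSum fun s _ => hI2 s]
    refine Finset.sum_congr rfl fun s _ => ?_
    rw [intervalIntegral.integral_const_mul,
      intervalIntegral.integral_finsetSum fun i _ => hint _]
    congr 1
    refine Finset.sum_congr rfl fun i hi => ?_
    have h := hPB s i hi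
    exact integral_levelIndicator (hv0 i _ h) (hv1 i _ h)
  rwa [e1, e2] at hmono

/-- The planning algorithm, evaluated at its virtual states, collects in every round at least
`γ_k` times the optimal value of the linear program. -/
lemma gammaK_mul_lpValue_le {n k τmax L : ℕ} (hk : 1 ≤ k) (c : Choices n k τmax L)
    (p : Fin n → State → ℝ) (t : ℕ)
    (hp0 : ∀ i (τ : State), 0 ≤ p i τ) (hp1 : ∀ i (τ : State), p i τ ≤ 1) :
    gammaK k * lpValue p (c.solve p) ≤ ∑ s : Seed n τmax L, seedProb (c.solve p) s *
      ∑ i ∈ planPlay c p s t, virtualPayoff p s t i := by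
  have hx := (c.solve_optimal p).1
  have h := gammaK_mul_le_sum_maximal hk (armWeight (c.solve p)) (armWeight_nonneg hx)
    (sum_armWeight _) (fun _ o => isCandidate t o) (fun i o => seedValue (p i) t o)
    (fun i o _ => by rcases o with _ | ⟨I, r⟩ <;> simp [seedValue, hp0])
    (fun i o _ => by rcases o with _ | ⟨I, r⟩ <;> simp [seedValue, hp1])
    ?_ (fun s => planPlay c p s t)
    (fun s i hi => (mem_candidates s t i).1 (c.pick_subset _ _ hi))
    (fun s => c.pick_card _ _)
    (fun s S hS hSk => c.pick_max _ _ S (fun i hi => (mem_candidates s t i).2 (hS i hi)) hSk)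
  · refine le_trans (le_of_eq ?_) h
    simp only [sum_armWeight_mul, lpValue]
  · have h1 : ∀ i, ∑ o, armWeight (c.solve p) i o *
        (if isCandidate t o then 1 else 0)
        = ∑ I : Interval τmax L, (I.plays : ℝ) * c.solve p i I := by
      intro i
      have := sum_armWeight_mul (c.solve p) i (fun _ => 1) t
      simp only [Interval.aggPayoff_one] at this
      rw [← this]
      refine Finset.sum_congr rfl fun o _ => ?_
      rcases o with _ | ⟨I, r⟩ <;> simp [isCandidate, seedValue]
    simp only [h1]
    exact hx.total

end Planning

/-! ### Trajectories of single arms -/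

/-- The state of an arm that starts in `σ` and is played in round `t` iff `b t`. -/
def armState (b : ℕ → Bool) (σ : State) : ℕ → State
  | 0 => σ
  | t + 1 => step (b t) (armState b σ t)

lemma stateAt_add {n : ℕ} (A : ℕ → Finset (Fin n)) (i : Fin n) (t r : ℕ) :
    stateAt A (t + r) i = armState (fun j => decide (i ∈ A (t + j))) (stateAt A t i) r := by
  induction r with
  | zero => rfl
  | succ r ih =>
    show step _ (stateAt A (t + r) i) = step _ _
    rw [ih]
    rfl

lemma stateAt_eq_armState {n : ℕ} (A : ℕ → Finset (Fin n)) (i : Fin n) (t : ℕ) :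
    stateAt A t i = armState (fun j => decide (i ∈ A j)) (posState 0) t := by
  have h := stateAt_add A i 0 t
  simp only [zero_add] at h
  exact h

lemma step_val (b : Bool) (τ : State) : (step b τ).1 =
    if b then (if τ.1 < 0 then τ.1 - 1 else -1) else (if τ.1 < 0 then 1 else τ.1 + 1) := by
  unfold step
  split_ifs <;> simp [negState, posState]

/-- Transitions preserve the order of states if the arm in the larger state is played only when
the other one is. -/
lemma step_mono {b b' : Bool} (hb : b' = true → b = true) {τ σ : State} (h : τ ≤ σ) :
    step b τ ≤ step b' σ := by
  have h : τ.1 ≤ σ.1 := h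
  show (step b τ).1 ≤ (step b' σ).1
  have hσ := σ.2
  rw [step_val, step_val]
  split_ifs <;> first | omega | exact absurd (hb ‹_›) ‹_›

/-- The planning algorithm plays arms at states that are at least their virtual states, once this
holds initially. -/
lemma virtualState_le_stateAt {n τmax L : ℕ} (A : ℕ → Finset (Fin n)) (s : Seed n τmax L) (N : ℕ)
    (hA : ∀ j, A (N + j) ⊆ candidates s (j + 1)) {i : Fin n}
    (hN : (τmax : ℤ) ≤ (stateAt A N i).1) {I : Interval τmax L} {r : Fin I.length}
    (hs : s i = some ⟨I, r⟩) (j : ℕ) :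
    virtualState I r (j + 1) ≤ stateAt A (N + j) i := by
  induction j with
  | zero => exact (I.virtualState_bounds r (0 + 1)).2.1.trans hN
  | succ j ih =>
    rw [← add_assoc, stateAt, Interval.virtualState_succ]
    refine step_mono (fun h => ?_) ih
    have := hA j (of_decide_eq_true h)
    rw [mem_candidates, hs] at this
    exact this

/-! ### The linear program bounds the optimal payoff -/

section Optimum

variable {n k τmax L : ℕ}

lemma sum_mul_add_single {ι : Type*} [Fintype ι] [DecidableEq ι] (f y : ι → ℝ) (j : ι) (c : ℝ) :
    ∑ i, f i * (y + Pi.single j c : ι → ℝ) i = ∑ i, f i * y i + f j * c := by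
  simp [mul_add, Finset.sum_add_distrib, Pi.single_apply]

lemma length_mk (a : Fin τmax) (d : Fin L) :
    ((Interval.length (a, d) : ℕ) : ℝ) = (a : ℕ) + 1 + ((d : ℕ) + 1) := by
  simp [Interval.length]

lemma plays_mk (a : Fin τmax) (d : Fin L) :
    ((Interval.plays (a, d) : ℕ) : ℝ) = (d : ℕ) + 1 := by
  simp [Interval.plays]

lemma aggPayoff_mk (a : Fin τmax) (d : Fin L) (q : State → ℝ) :
    Interval.aggPayoff (a, d) q = q (posState a) + ∑ j ∈ Finset.range d, q (negState j) := rfl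

/-- The trajectory of one arm over `t` rounds is covered by nonnegative multiples of recurrent
intervals of total length at most `t + 1`, with no more plays, and with at least the fraction
`L / (L + 1)` of the payoff. A cycle of the trajectory contributes its interval, with `u` truncated
at `τmax`. In a run of plays beyond state `-L`, every further play contributes the multiple
`1 / (L + 1)` of the interval `I(1, -L)`, which has length `1`. While a run of plays is in
progress, its interval `I` is kept apart from the finished ones, which are collected in `y`. -/
lemma exists_interval_cover (hL : 1 ≤ L) (hτ : 1 ≤ τmax) (q : State → ℝ) (h0 : ∀ τ, 0 ≤ q τ)
    (hmono : Monotone q)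
    (hsat : ∀ τ σ : State, (τmax : ℤ) ≤ τ.1 → (τmax : ℤ) ≤ σ.1 → q τ = q σ) {ρ : ℝ}
    (hρ : ρ * (L + 1) ≤ L) (b : ℕ → Bool) (t : ℕ) :
    ∃ y : Interval τmax L → ℝ, (∀ I, 0 ≤ y I) ∧
      ∑ I, (I.length : ℝ) * y I ≤ t + 1 ∧
      ∑ I, (I.plays : ℝ) * y I ≤ ∑ s ∈ Finset.range t, (if b s then 1 else 0) ∧
      ρ * ∑ s ∈ Finset.range t, (if b s then q (armState b (posState 0) s) else 0)
        ≤ ∑ I, I.aggPayoff q * y I := by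
  have hL' : (0 : ℝ) < L + 1 := by positivity
  have hL1 : ((L - 1 : ℕ) : ℝ) = L - 1 := by rw [Nat.cast_sub hL]; simp
  have hρ1 : ρ ≤ 1 := by
    by_contra! h
    nlinarith
  suffices h : (∃ (m : ℕ) (y : Interval τmax L → ℝ), armState b (posState 0) t = posState m ∧
      (∀ I, 0 ≤ y I) ∧ ∑ I, (I.length : ℝ) * y I + m ≤ t ∧
      ∑ I, (I.plays : ℝ) * y I ≤ ∑ s ∈ Finset.range t, (if b s then 1 else 0) ∧
      ρ * ∑ s ∈ Finset.range t, (if b s then q (armState b (posState 0) s) else 0)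
        ≤ ∑ I, I.aggPayoff q * y I) ∨
    (∃ (m : ℕ) (J : Interval τmax L) (y : Interval τmax L → ℝ),
      armState b (posState 0) t = negState m ∧ (J.2 : ℕ) = min m (L - 1) ∧
      (∀ I, 0 ≤ y I) ∧ ∑ I, (I.length : ℝ) * y I + J.length ≤ t + 1 ∧
      ∑ I, (I.plays : ℝ) * y I + J.plays ≤ ∑ s ∈ Finset.range t, (if b s then 1 else 0) ∧
      ρ * ∑ s ∈ Finset.range t, (if b s then q (armState b (posState 0) s) else 0)
        ≤ ∑ I, I.aggPayoff q * y I + J.aggPayoff q) by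
    rcases h with ⟨m, y, -, hy, h1, h2, h3⟩ | ⟨m, J, y, -, -, hy, h1, h2, h3⟩
    · refine ⟨y, hy, ?_, h2, h3⟩
      have : (0 : ℝ) ≤ m := by positivity
      linarith
    · refine ⟨y + Pi.single J 1, fun I => add_nonneg (hy I) ?_, ?_, ?_, ?_⟩
      · rw [Pi.single_apply]; split_ifs <;> norm_num
      all_goals rw [sum_mul_add_single, mul_one]; assumption
  induction t with
  | zero =>
    left
    exact ⟨0, 0, rfl, fun _ => le_rfl, by simp, by simp, by simp⟩
  | succ t ih =>
    simp only [Finset.sum_range_succ, mul_add ρ]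
    push_cast
    rcases ih with ⟨m, y, hσ, hy, h1, h2, h3⟩ | ⟨m, ⟨a, d⟩, y, hσ, hJ, hy, h1, h2, h3⟩
    · by_cases hb : b t
      · right
        refine ⟨0, (⟨min m (τmax - 1), by omega⟩, ⟨0, hL⟩), y, ?_, ?_, hy, ?_, ?_, ?_⟩
        · rw [armState, hb, hσ, Interval.step_true_posState]
        · simp
        · have : ((min m (τmax - 1) : ℕ) : ℝ) ≤ m := by exact_mod_cast min_le_left _ _
          rw [length_mk]
          simp only [CharP.cast_eq_zero]
          linarith
        · rw [plays_mk]
          simp only [hb, if_true, CharP.cast_eq_zero]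
          linarith
        · have hq : q (posState m) = q (posState (min m (τmax - 1))) := by
            rcases le_total m (τmax - 1) with h | h
            · rw [min_eq_left h]
            · rw [min_eq_right h]
              apply hsat <;> simp only [posState] <;> omega
          rw [aggPayoff_mk]
          simp only [hb, if_true, hσ, hq, Finset.range_zero, Finset.sum_empty, add_zero]
          have := mul_le_of_le_one_left (h0 (posState (min m (τmax - 1)))) hρ1
          linarith
      · left
        refine ⟨m + 1, y, ?_, hy, ?_, ?_, ?_⟩
        · rw [armState, hσ, Bool.eq_false_iff.2 hb, Interval.step_false_posState]
        · push_cast; linarith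
        · simpa [hb] using h2
        · simpa [hb] using h3
    · by_cases hb : b t
      · right
        rcases lt_or_ge m (L - 1) with hm | hm
        · have hdm : (d : ℕ) = m := hJ.trans (min_eq_left hm.le)
          have hdm' : ((d : ℕ) : ℝ) = m := by exact_mod_cast hdm
          refine ⟨m + 1, (a, ⟨m + 1, by omega⟩), y, ?_, ?_, hy, ?_, ?_, ?_⟩
          · rw [armState, hb, hσ, Interval.step_true_negState]
          · simp only; omega
          · rw [length_mk] at h1 ⊢
            push_cast
            linarith
          · rw [plays_mk] at h2 ⊢
            simp only [hb, if_true]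
            push_cast
            linarith
          · rw [aggPayoff_mk] at h3 ⊢
            simp only [hb, if_true, hσ, hdm] at h3 ⊢
            rw [Finset.sum_range_succ]
            have := mul_le_of_le_one_left (h0 (negState m)) hρ1
            linarith
        · refine ⟨m + 1, (a, d), y + Pi.single (⟨0, hτ⟩, ⟨L - 1, by omega⟩) (1 / ((L : ℝ) + 1)),
            ?_, ?_, ?_, ?_, ?_, ?_⟩
          · rw [armState, hb, hσ, Interval.step_true_negState]
          · simp only at hJ ⊢; omega
          · refine fun I => add_nonneg (hy I) ?_
            rw [Pi.single_apply]; split_ifs <;> positivity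
          all_goals rw [sum_mul_add_single]
          · have : ((Interval.length ((⟨0, hτ⟩, ⟨L - 1, by omega⟩) : Interval τmax L) : ℕ) : ℝ)
                * (1 / ((L : ℝ) + 1)) = 1 := by
              rw [length_mk]
              simp only [hL1]
              field_simp
              push_cast
              ring
            rw [this]
            linarith
          · have : ((Interval.plays ((⟨0, hτ⟩, ⟨L - 1, by omega⟩) : Interval τmax L) : ℕ) : ℝ)
                * (1 / ((L : ℝ) + 1)) ≤ 1 := by
              rw [plays_mk, mul_one_div, div_le_one hL']
              simp only [hL1]
              linarith
            simp only [hb, if_true]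
            linarith
          · simp only [hb, if_true, hσ]
            have key : (L : ℝ) * q (negState m) ≤
                Interval.aggPayoff ((⟨0, hτ⟩, ⟨L - 1, by omega⟩) : Interval τmax L) q := by
              have h4 : ∑ j ∈ Finset.range (L - 1), q (negState m)
                  ≤ ∑ j ∈ Finset.range (L - 1), q (negState j) := by
                refine Finset.sum_le_sum fun j hj => hmono ?_
                rw [Finset.mem_range] at hj
                show -((m : ℤ) + 1) ≤ -((j : ℤ) + 1)
                omega
              have h5 : q (negState m) ≤ q (posState 0) := by
                refine hmono ?_
                show -((m : ℤ) + 1) ≤ ((0 : ℕ) : ℤ) + 1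
                omega
              have h6 : (L : ℝ) = ((L - 1 : ℕ) : ℝ) + 1 := by rw [hL1]; ring
              rw [Finset.sum_const, Finset.card_range, nsmul_eq_mul] at h4
              rw [aggPayoff_mk]
              rw [h6, add_mul, one_mul]
              linarith
            have h7 : ρ * q (negState m) ≤
                Interval.aggPayoff ((⟨0, hτ⟩, ⟨L - 1, by omega⟩) : Interval τmax L) q
                  * (1 / ((L : ℝ) + 1)) := by
              rw [mul_one_div, le_div_iff₀ hL']
              nlinarith [h0 (negState m)]
            linarith
      · left
        refine ⟨0, y + Pi.single (a, d) 1, ?_, fun I => add_nonneg (hy I) ?_, ?_, ?_, ?_⟩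
        · rw [armState, hσ, Bool.eq_false_iff.2 hb, Interval.step_false_negState]
        · rw [Pi.single_apply]; split_ifs <;> norm_num
        · rw [sum_mul_add_single]; push_cast; linarith
        · rw [sum_mul_add_single]; simpa [hb] using h2
        · rw [sum_mul_add_single]; simpa [hb] using h3

lemma aggPayoff_mono (I : Interval τmax L) {q q' : State → ℝ} (h : ∀ τ, q τ ≤ q' τ) :
    I.aggPayoff q ≤ I.aggPayoff q' :=
  add_le_add (h _) (Finset.sum_le_sum fun _ _ => h _)

lemma lpValue_nonneg {p : Fin n → State → ℝ} (h0 : ∀ i τ, 0 ≤ p i τ)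
    {x : Fin n → Interval τmax L → ℝ} (hx : LPFeasible k τmax L x) : 0 ≤ lpValue p x :=
  Finset.sum_nonneg fun i _ => Finset.sum_nonneg fun I _ =>
    mul_nonneg (add_nonneg (h0 _ _) (Finset.sum_nonneg fun _ _ => h0 _ _)) (hx.nonneg i I)

lemma lpValue_le {p : Fin n → State → ℝ} (h1 : ∀ i τ, p i τ ≤ 1)
    {x : Fin n → Interval τmax L → ℝ} (hx : LPFeasible k τmax L x) : lpValue p x ≤ k := by
  refine le_trans (Finset.sum_le_sum fun i _ => Finset.sum_le_sum fun I _ => ?_) hx.total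
  refine mul_le_mul_of_nonneg_right ?_ (hx.nonneg i I)
  rw [← I.aggPayoff_one]
  exact aggPayoff_mono I (h1 i)

lemma totalPayoff_le {p : Fin n → State → ℝ} (h1 : ∀ i τ, p i τ ≤ 1)
    {A : ℕ → Finset (Fin n)} (hA : ∀ t, (A t).card ≤ k) (T : ℕ) :
    totalPayoff p A T ≤ T * k := by
  refine (Finset.sum_le_card_nsmul _ _ (k : ℝ) fun t _ => ?_).trans (by simp)
  refine (Finset.sum_le_card_nsmul _ _ (1 : ℝ) fun i _ => h1 _ _).trans ?_
  simpa using hA t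

lemma opt_le {p : Fin n → State → ℝ} (h1 : ∀ i τ, p i τ ≤ 1) (T : ℕ) :
    opt k p T ≤ T * k := by
  refine csSup_le ⟨_, fun _ => ∅, by simp, rfl⟩ ?_
  rintro r ⟨A, hA, rfl⟩
  exact totalPayoff_le h1 hA T

/-- The value of the linear program bounds the optimal payoff per round, up to the factor
`ρ ≤ L / (L + 1)` and one additional round. -/
lemma mul_opt_le_lpValue (hL : 1 ≤ L) (hτ : 1 ≤ τmax) {p : Fin n → State → ℝ}
    (hp : IsPayoff τmax p) {ρ : ℝ} (hρ0 : 0 < ρ) (hρ : ρ * (L + 1) ≤ L)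
    {x : Fin n → Interval τmax L → ℝ} (hx : LPOptimal k τmax L p x) (T : ℕ) :
    ρ * opt k p T ≤ (T + 1) * lpValue p x := by
  rw [← le_div_iff₀' hρ0]
  refine csSup_le ⟨_, fun _ => ∅, by simp, rfl⟩ ?_
  rintro r ⟨A, hA, rfl⟩
  rw [le_div_iff₀' hρ0]
  choose y hy0 hylen hyplays hyagg using fun i =>
    exists_interval_cover hL hτ (p i) (hp.nonneg i) (hp.mono i)
    (hp.saturation_upper i) hρ (fun t => decide (i ∈ A t)) T
  have hT : (0 : ℝ) < T + 1 := by positivity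
  have hfeas : LPFeasible k τmax L (fun i I => y i I / (T + 1)) := by
    refine ⟨fun i I => div_nonneg (hy0 i I) hT.le, ?_, fun i => ?_⟩
    · have h1 : ∑ i, ∑ I : Interval τmax L, (I.plays : ℝ) * y i I ≤ T * k := by
        refine (Finset.sum_le_sum fun i _ => hyplays i).trans ?_
        rw [Finset.sum_comm]
        refine (Finset.sum_le_card_nsmul _ _ (k : ℝ) fun t _ => ?_).trans (by simp)
        simp only [decide_eq_true_eq, Finset.sum_boole, Finset.filter_univ_mem]
        exact_mod_cast hA t
      simp only [← mul_div_assoc, ← Finset.sum_div]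
      rw [div_le_iff₀ hT]
      have : (0 : ℝ) ≤ k := by positivity
      linarith
    · simp only [← mul_div_assoc, ← Finset.sum_div]
      rw [div_le_one hT]
      exact hylen i
  have h2 := hx.2 _ hfeas
  have h3 : lpValue p (fun i I => y i I / (T + 1)) = (∑ i, ∑ I : Interval τmax L,
      I.aggPayoff (p i) * y i I) / (T + 1) := by
    simp only [lpValue, ← mul_div_assoc, ← Finset.sum_div]
  rw [h3, div_le_iff₀' hT] at h2
  refine le_trans ?_ h2
  have h4 : totalPayoff p A T = ∑ i, ∑ t ∈ Finset.range T,
      (if decide (i ∈ A t) then p i (armState (fun t => decide (i ∈ A t)) (posState 0) t)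
        else 0) := by
    rw [Finset.sum_comm]
    refine Finset.sum_congr rfl fun t _ => ?_
    simp only [decide_eq_true_eq, ← Finset.sum_filter, Finset.filter_univ_mem,
      stateAt_eq_armState]
  rw [h4, Finset.mul_sum]
  exact Finset.sum_le_sum fun i _ => hyagg i

end Optimum

/-! ### Measurable choices -/

/-- A maximizer over a finite index set can be chosen measurably: take the first one. -/
lemma exists_measurable_argmax {α ι : Type*} [MeasurableSpace α] [Finite ι] [Nonempty ι]
    (f : ι → α → ℝ) (hf : ∀ j, Measurable (f j)) :
    ∃ g : α → ι, (∀ a j, f j a ≤ f (g a) a) ∧ ∀ j, MeasurableSet {a | g a = j} := by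
  obtain ⟨m, ⟨e⟩⟩ := Finite.exists_equiv_fin ι
  have hex : ∀ a, ∃ j : Fin m, (∀ j', f j' a ≤ f (e.symm j) a) ∧
      ∀ i < j, ¬ ∀ j', f j' a ≤ f (e.symm i) a := by
    intro a
    have hne : {j : Fin m | ∀ j', f j' a ≤ f (e.symm j) a}.Nonempty := by
      obtain ⟨j, hj⟩ := Finite.exists_max fun j => f j a
      exact ⟨e j, by simpa using hj⟩
    obtain ⟨j, hj, hmin⟩ := (wellFounded_lt (α := Fin m)).has_min _ hne
    exact ⟨j, hj, fun i hi h => hmin i h hi⟩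
  choose g hg hmin using hex
  refine ⟨fun a => e.symm (g a), hg, fun j => ?_⟩
  have hset : {a | e.symm (g a) = j} = {a | (∀ j', f j' a ≤ f j a) ∧
      ∀ i < e j, ¬ ∀ j', f j' a ≤ f (e.symm i) a} := by
    ext a
    simp only [Set.mem_ofPred_eq]
    constructor
    · rintro rfl
      refine ⟨hg a, ?_⟩
      simpa using hmin a
    · rintro ⟨h1, h2⟩
      rw [Equiv.symm_apply_eq]
      rcases lt_trichotomy (g a) (e j) with h | h | h
      · exact absurd (hg a) (h2 _ h)
      · exact h
      · exact absurd (by simpa using h1) (hmin a _ h)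
  rw [hset]
  have hmax : ∀ j, MeasurableSet {a | ∀ j', f j' a ≤ f j a} := fun j => by
    rw [Set.ofPred_forall]
    exact MeasurableSet.iInter fun j' => measurableSet_le (hf j') (hf j)
  refine (hmax j).inter ?_
  have : {a | ∀ i < e j, ¬ ∀ j', f j' a ≤ f (e.symm i) a}
      = ⋂ i : Fin m, ⋂ _ : i < e j, {a | ∀ j', f j' a ≤ f (e.symm i) a}ᶜ := by
    ext a; simp
  change MeasurableSet {a | ∀ i < e j, ¬ ∀ j', f j' a ≤ f (e.symm i) a}
  rw [this]
  exact MeasurableSet.iInter fun i => MeasurableSet.iInter fun _ => (hmax _).compl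

/-- Finitely many points of a compact polyhedron suffice to maximize all linear functionals: for
every set `S` of constraints, take a point at which all constraints of `S` are tight. If `x` is
optimal for a functional, then so is every `y` at which the constraints that are tight at `x` are
tight, because `x + t (x - y)` is feasible for small `t > 0`. -/
lemma exists_finite_maximizers {E ι : Type*} [AddCommGroup E] [Module ℝ E] [TopologicalSpace E]
    [Finite ι] (a : ι → E →ₗ[ℝ] ℝ) (b : ι → ℝ) (hK : IsCompact {x | ∀ j, a j x ≤ b j})
    (hne : {x | ∀ j, a j x ≤ b j}.Nonempty) :
    ∃ v : Set ι → E, (∀ S j, a j (v S) ≤ b j) ∧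
      ∀ q : E →ₗ[ℝ] ℝ, Continuous q → ∃ S, ∀ y, (∀ j, a j y ≤ b j) → q y ≤ q (v S) := by
  classical
  obtain ⟨x₀, hx₀⟩ := hne
  let v : Set ι → E := fun S =>
    if h : ∃ x, (∀ j, a j x ≤ b j) ∧ ∀ j ∈ S, a j x = b j then h.choose else x₀
  refine ⟨v, fun S => ?_, fun q hq => ?_⟩
  · by_cases h : ∃ x, (∀ j, a j x ≤ b j) ∧ ∀ j ∈ S, a j x = b j
    · simp only [v, dif_pos h]; exact h.choose_spec.1
    · simp only [v, dif_neg h]; exact hx₀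
  obtain ⟨x, hx, hmax⟩ := hK.exists_isMaxOn ⟨x₀, hx₀⟩ hq.continuousOn
  have hmax' : ∀ y, (∀ j, a j y ≤ b j) → q y ≤ q x := fun y hy => hmax hy
  have h : ∃ y, (∀ j, a j y ≤ b j) ∧ ∀ j ∈ {j | a j x = b j}, a j y = b j :=
    ⟨x, hx, fun j hj => hj⟩
  refine ⟨{j | a j x = b j}, fun z hz => (hmax' z hz).trans ?_⟩
  obtain ⟨hy, hty⟩ : (∀ j, a j (v {j | a j x = b j}) ≤ b j) ∧
      ∀ j ∈ {j | a j x = b j}, a j (v {j | a j x = b j}) = b j := by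
    simp only [v, dif_pos h]; exact h.choose_spec
  generalize v {j | a j x = b j} = y at hy hty
  have hsmall : ∀ᶠ t : ℝ in nhdsWithin 0 (Set.Ioi 0), ∀ j, a j (x + t • (x - y)) ≤ b j := by
    rw [Filter.eventually_all]
    intro j
    by_cases hj : a j x = b j
    · refine Filter.Eventually.of_forall fun t => ?_
      have : a j y = b j := hty j hj
      simp [hj, this]
    · have hlt : a j x < b j := lt_of_le_of_ne (hx j) hj
      have hc : Continuous fun t : ℝ => a j (x + t • (x - y)) := by
        simp only [map_add, map_smul, smul_eq_mul]
        fun_prop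
      have h0 : ∀ᶠ t in nhds (0 : ℝ), a j (x + t • (x - y)) < b j :=
        hc.continuousAt.eventually_lt continuousAt_const (by simpa using hlt)
      exact (h0.filter_mono nhdsWithin_le_nhds).mono fun t ht => ht.le
  obtain ⟨t, ht, ht0⟩ := (hsmall.and self_mem_nhdsWithin).exists
  have h1 := hmax' _ ht
  simp only [map_add, map_smul, map_sub, smul_eq_mul] at h1
  have ht0 : 0 < t := ht0
  nlinarith

section Choices

variable (n k τmax L : ℕ)

/-- The coordinate `x i I` of a vector as a linear functional. -/
def coordinate (i : Fin n) (I : Interval τmax L) :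
    (Fin n → Interval τmax L → ℝ) →ₗ[ℝ] ℝ where
  toFun x := x i I
  map_add' _ _ := rfl
  map_smul' _ _ := rfl

/-- The constraints of the linear program: nonnegativity, the total number of plays, and the
total length for every arm, as upper bounds on linear functionals. -/
def lpConstraint : (Fin n × Interval τmax L) ⊕ (Unit ⊕ Fin n) →
    (Fin n → Interval τmax L → ℝ) →ₗ[ℝ] ℝ
  | .inl j => -coordinate n τmax L j.1 j.2
  | .inr (.inl _) => ∑ i, ∑ I : Interval τmax L,
      (I.plays : ℝ) • coordinate n τmax L i I
  | .inr (.inr i) => ∑ I : Interval τmax L,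
      (I.length : ℝ) • coordinate n τmax L i I

/-- The right-hand sides of the constraints of the linear program. -/
def lpBound : (Fin n × Interval τmax L) ⊕ (Unit ⊕ Fin n) → ℝ
  | .inl _ => 0
  | .inr (.inl _) => k
  | .inr (.inr _) => 1

variable {n k τmax L}

lemma coordinate_apply (i : Fin n) (I : Interval τmax L) (x : Fin n → Interval τmax L → ℝ) :
    coordinate n τmax L i I x = x i I := rfl

lemma lpFeasible_iff (x : Fin n → Interval τmax L → ℝ) :
    LPFeasible k τmax L x ↔ ∀ j, lpConstraint n τmax L j x ≤ lpBound n k τmax L j := by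
  simp only [Sum.forall, Prod.forall, lpConstraint, lpBound, LinearMap.neg_apply,
    coordinate_apply, LinearMap.sum_apply, LinearMap.smul_apply,
    smul_eq_mul, neg_nonpos, forall_const]
  exact ⟨fun h => ⟨fun i a d => h.nonneg i (a, d), h.total, h.arm⟩,
    fun h => ⟨fun i I => h.1 i I.1 I.2, h.2.1, h.2.2⟩⟩

lemma LPFeasible.le_one {x : Fin n → Interval τmax L → ℝ} (hx : LPFeasible k τmax L x)
    (i : Fin n) (I : Interval τmax L) : x i I ≤ 1 := by
  have h1 : (1 : ℝ) ≤ I.length := by exact_mod_cast I.length_pos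
  have h2 := Finset.single_le_sum (f := fun I : Interval τmax L => (I.length : ℝ) * x i I)
    (fun J _ => mul_nonneg (by positivity) (hx.nonneg i J)) (Finset.mem_univ I)
  have h3 := hx.arm i
  have h4 := hx.nonneg i I
  nlinarith

lemma isCompact_lpFeasible :
    IsCompact {x | ∀ j, lpConstraint n τmax L j x ≤ lpBound n k τmax L j} := by
  have hcube : IsCompact (Set.univ.pi fun _ : Fin n =>
      Set.univ.pi fun _ : Interval τmax L => Set.Icc (0 : ℝ) 1) :=
    isCompact_univ_pi fun _ => isCompact_univ_pi fun _ => isCompact_Icc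
  refine hcube.of_isClosed_subset ?_ fun x hx => ?_
  · rw [Set.ofPred_forall]
    exact isClosed_iInter fun j => isClosed_le
      (LinearMap.continuous_of_finiteDimensional _) continuous_const
  · have hx := (lpFeasible_iff x).2 hx
    exact fun i _ I _ => ⟨hx.nonneg i I, hx.le_one i I⟩

/-- The objective of the linear program as a linear functional. -/
def lpObjective (p : Fin n → State → ℝ) : (Fin n → Interval τmax L → ℝ) →ₗ[ℝ] ℝ :=
  ∑ i, ∑ I : Interval τmax L,
    (I.aggPayoff (p i)) • coordinate n τmax L i I

lemma lpObjective_apply (p : Fin n → State → ℝ) (x : Fin n → Interval τmax L → ℝ) :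
    lpObjective p x = lpValue p x := by
  simp [lpObjective, lpValue, coordinate_apply]

lemma measurable_apply_apply (i : Fin n) (τ : State) :
    Measurable fun p : Fin n → State → ℝ => p i τ :=
  (measurable_pi_apply τ).comp (measurable_pi_apply i)

lemma measurable_lpValue (x : Fin n → Interval τmax L → ℝ) :
    Measurable fun p : Fin n → State → ℝ => lpValue p x := by
  refine Finset.measurable_sum _ fun i _ => Finset.measurable_sum _ fun I _ => ?_
  refine Measurable.mul_const ?_ _
  exact (measurable_apply_apply i _).add
    (Finset.measurable_sum _ fun j _ => measurable_apply_apply i _)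

lemma exists_measurable_solution :
    ∃ f : (Fin n → State → ℝ) → Fin n → Interval τmax L → ℝ,
      (∀ p, LPOptimal k τmax L p (f p)) ∧ Measurable f := by
  obtain ⟨v, hv, hmax⟩ := exists_finite_maximizers (lpConstraint n τmax L) (lpBound n k τmax L)
    isCompact_lpFeasible ⟨0, fun j => by rcases j with j | j | j <;> simp [lpBound]⟩
  obtain ⟨g, hg, hgm⟩ := exists_measurable_argmax (fun S p => lpValue p (v S))
    (fun S => measurable_lpValue (v S))
  refine ⟨fun p => v (g p), fun p => ⟨(lpFeasible_iff _).2 (hv _), fun y hy => ?_⟩, ?_⟩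
  · obtain ⟨S, hS⟩ := hmax (lpObjective p) (LinearMap.continuous_of_finiteDimensional _)
    have := hS y ((lpFeasible_iff y).1 hy)
    rw [lpObjective_apply, lpObjective_apply] at this
    exact this.trans (hg p S)
  · let : MeasurableSpace (Set ((Fin n × Interval τmax L) ⊕ (Unit ⊕ Fin n))) := ⊤
    have h1 : Measurable g := measurable_to_countable' fun S => hgm S
    exact (measurable_from_top (f := v)).comp h1

lemma exists_measurable_pick (C : Finset (Fin n)) :
    ∃ f : (Fin n → ℝ) → Finset (Fin n), (∀ w, f w ⊆ C) ∧ (∀ w, (f w).card ≤ k) ∧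
      (∀ w, ∀ S ⊆ C, S.card ≤ k → ∑ i ∈ S, w i ≤ ∑ i ∈ f w, w i) ∧
      ∀ S, MeasurableSet {w | f w = S} := by
  have : Nonempty {S : Finset (Fin n) // S ⊆ C ∧ S.card ≤ k} := ⟨⟨∅, by simp, by simp⟩⟩
  obtain ⟨g, hg, hgm⟩ := exists_measurable_argmax
    (fun (S : {S : Finset (Fin n) // S ⊆ C ∧ S.card ≤ k}) (w : Fin n → ℝ) => ∑ i ∈ S.1, w i)
    (fun S => Finset.measurable_sum _ fun i _ => measurable_pi_apply i)
  refine ⟨fun w => (g w).1, fun w => (g w).2.1, fun w => (g w).2.2,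
    fun w S hS hk => hg w ⟨S, hS, hk⟩, fun S => ?_⟩
  by_cases hS : S ⊆ C ∧ S.card ≤ k
  · have hset : {w | (g w).1 = S} = {w | g w = ⟨S, hS⟩} := by
      ext w
      exact ⟨fun h => Subtype.ext h, fun h => congrArg Subtype.val h⟩
    exact hset ▸ hgm ⟨S, hS⟩
  · convert MeasurableSet.empty
    ext w
    simp only [Set.mem_ofPred_eq, Set.mem_empty_iff_false, iff_false]
    rintro rfl
    exact hS (g w).2

lemma nonempty_choices (n k τmax L : ℕ) : Nonempty (Choices n k τmax L) := by
  obtain ⟨f, hf, hfm⟩ := exists_measurable_solution (n := n) (k := k) (τmax := τmax) (L := L)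
  choose g hg1 hg2 hg3 hg4 using fun C : Finset (Fin n) => exists_measurable_pick (k := k) C
  exact ⟨⟨f, hf, hfm, fun w C => g C w, fun w C => hg1 C w, fun w C => hg2 C w,
    fun w C S => hg3 C w S, fun C S => hg4 C S⟩⟩

end Choices

/-! ### The exploration schedule -/

section Exploration

/-- Whether an arm is played in round `r` of an exploration block. The `m`-th window of length
`τmax + 2` (`m < τmax`) contains two plays, with `m + 1` idle rounds between them, so that the
second play happens in state `m + 1`. The windows are followed by a run of plays. -/
def blockPattern (τmax r : ℕ) : Bool :=
  if r < (τmax + 2) * τmax then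
    decide (r % (τmax + 2) + r / (τmax + 2) + 1 = τmax ∨ r % (τmax + 2) = τmax + 1)
  else true

lemma blockPattern_window {τmax m q : ℕ} (hm : m < τmax) (hq : q < τmax + 2) :
    blockPattern τmax ((τmax + 2) * m + q) = decide (q + m + 1 = τmax ∨ q = τmax + 1) := by
  have h1 : (τmax + 2) * m + q < (τmax + 2) * τmax := by nlinarith
  rw [blockPattern, if_pos h1, Nat.mul_add_mod, Nat.mod_eq_of_lt hq, Nat.mul_add_div (by omega),
    Nat.div_eq_of_lt hq, add_zero]

lemma blockPattern_run {τmax r : ℕ} : blockPattern τmax ((τmax + 2) * τmax + r) = true := by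
  simp [blockPattern]

lemma armState_play_idle {b : ℕ → Bool} (σ : State) {a m : ℕ} (ha : b a = true)
    (hidle : ∀ j ≤ m, b (a + 1 + j) = false) : armState b σ (a + 2 + m) = posState m := by
  induction m with
  | zero =>
    have h1 : armState b σ (a + 2) = step false (step true (armState b σ a)) := by
      rw [armState, armState, ha, ← hidle 0 le_rfl]
    rw [add_zero, h1]
    ext
    simp only [step_val, posState]
    have := (armState b σ a).2
    simp only [if_true, Bool.false_eq_true, if_false]
    split_ifs <;> first | rfl | omega
  | succ m ih =>
    have h := hidle (m + 1) le_rfl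
    rw [show a + 1 + (m + 1) = a + 2 + m by omega] at h
    rw [← add_assoc, armState, ih fun j hj => hidle j (by omega), h,
      Interval.step_false_posState]

lemma armState_idle {b : ℕ → Bool} (σ : State) {m : ℕ} (hidle : ∀ j ≤ m, b j = false) :
    (m : ℤ) + 1 ≤ (armState b σ (m + 1)).1 := by
  induction m with
  | zero =>
    rw [armState, hidle 0 le_rfl, step_val]
    have := (armState b σ 0).2
    simp only [Bool.false_eq_true, if_false]
    split_ifs <;> omega
  | succ m ih =>
    have := ih fun j hj => hidle j (by omega)
    rw [armState, hidle (m + 1) le_rfl, step_val]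
    simp only [Bool.false_eq_true, if_false]
    rw [if_neg (by omega)]
    push_cast
    omega

lemma exists_eq_posState_or_negState (τ : State) :
    (∃ m : ℕ, τ = posState m) ∨ ∃ m : ℕ, τ = negState m := by
  obtain ⟨τ, hτ⟩ := τ
  rcases lt_or_gt_of_ne hτ with h | h
  · right
    refine ⟨(-τ - 1).toNat, Subtype.ext ?_⟩
    simp only [negState]
    omega
  · left
    refine ⟨(τ - 1).toNat, Subtype.ext ?_⟩
    simp only [posState]
    omega

/-- From any starting state, an exploration block visits and plays every state in the range. -/
lemma exists_play_in_block {τmax L : ℕ} (hτ : 1 ≤ τmax) {b : ℕ → Bool} (σ : State)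
    (hb : ∀ r < (τmax + 2) * τmax + L, b r = blockPattern τmax r) (τ : State)
    (hl : -(L : ℤ) ≤ τ.1) (hu : τ.1 ≤ τmax) :
    ∃ r < (τmax + 2) * τmax + L, b r = true ∧ armState b σ r = τ := by
  have hpos : ∀ m < τmax, b ((τmax + 2) * m + (τmax + 1)) = true ∧
      armState b σ ((τmax + 2) * m + (τmax + 1)) = posState m := by
    intro m hm
    have hlt : ∀ q < τmax + 2, (τmax + 2) * m + q < (τmax + 2) * τmax + L := by
      intro q hq; nlinarith
    have hwin : ∀ q < τmax + 2, b ((τmax + 2) * m + q)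
        = decide (q + m + 1 = τmax ∨ q = τmax + 1) := fun q hq => by
      rw [hb _ (hlt q hq), blockPattern_window hm hq]
    refine ⟨by rw [hwin _ (by omega)]; simp, ?_⟩
    have ha : b ((τmax + 2) * m + (τmax - 1 - m)) = true := by
      rw [hwin _ (by omega), decide_eq_true_eq]; left; omega
    have hidle : ∀ j ≤ m, b ((τmax + 2) * m + (τmax - 1 - m) + 1 + j) = false := by
      intro j hj
      rw [show (τmax + 2) * m + (τmax - 1 - m) + 1 + j
        = (τmax + 2) * m + (τmax - 1 - m + 1 + j) by omega, hwin _ (by omega),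
        decide_eq_false_iff_not]
      omega
    have := armState_play_idle σ ha hidle
    rwa [show (τmax + 2) * m + (τmax - 1 - m) + 2 + m
        = (τmax + 2) * m + (τmax + 1) by omega] at this
  rcases exists_eq_posState_or_negState τ with ⟨m, rfl⟩ | ⟨m, rfl⟩
  · have hm : m < τmax := by simp only [posState] at hu; omega
    exact ⟨_, by nlinarith, hpos m hm⟩
  · have hm : m < L := by simp only [negState] at hl; omega
    have hneg : ∀ j ≤ L, armState b σ ((τmax + 2) * τmax + j) = negState j := by
      intro j hj
      induction j with
      | zero =>
        have h := hpos (τmax - 1) (by omega)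
        have he : (τmax + 2) * (τmax - 1) + (τmax + 1) + 1 = (τmax + 2) * τmax := by
          obtain ⟨c, rfl⟩ := Nat.exists_eq_add_of_le hτ
          simp only [Nat.add_sub_cancel_left]
          ring
        rw [add_zero, ← he, armState, h.1, h.2, Interval.step_true_posState]
      | succ j ih =>
        rw [← add_assoc, armState, ih (by omega), hb _ (by omega), blockPattern_run,
          Interval.step_true_negState]
    exact ⟨(τmax + 2) * τmax + m, by omega, by rw [hb _ (by omega), blockPattern_run],
      hneg m hm.le⟩

/-- There is an exploration schedule that samples every state in the range at least `M` times.
The arms are divided into groups of `k` consecutive arms, and in each of `M` passes every group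
receives one exploration block. The final `τmax` idle rounds bring all arms to states that are at
least `τmax`, so that afterwards all arms are at least as good as any virtual state. -/
lemma exists_exploration {n k τmax L M : ℕ} (hk : 1 ≤ k) (hτ : 1 ≤ τmax) (hM : 1 ≤ M) :
    ∃ E : Exploration n k τmax L,
      E.N = (n / k + 1) * M * ((τmax + 2) * τmax + L) + τmax ∧
      (∀ (i : Fin n) (τ : State), -(L : ℤ) ≤ τ.1 → τ.1 ≤ τmax → M ≤ (E.samples i τ).card) ∧
      ∀ i, (τmax : ℤ) ≤ (stateAt E.play E.N i).1 := by
  set B := (τmax + 2) * τmax + L with hB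
  set G := n / k + 1 with hG
  have hB0 : 0 < B := by rw [hB]; nlinarith
  have hG0 : 0 < G := Nat.succ_pos _
  let play : ℕ → Finset (Fin n) := fun t =>
    if t < G * M * B then
      Finset.univ.filter fun i : Fin n =>
        (i : ℕ) / k = (t / B) % G ∧ blockPattern τmax (t % B) = true
    else ∅
  have hcard : ∀ t, (play t).card ≤ k := by
    intro t
    simp only [play]
    split_ifs
    · calc _ ≤ (Finset.range k).card := by
            refine Finset.card_le_card_of_injOn (fun i : Fin n => (i : ℕ) % k) ?_ ?_
            · intro i _
              exact Finset.mem_coe.2 (Finset.mem_range.2 (Nat.mod_lt _ (by omega)))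
            · intro i hi j hj hij
              simp only [Finset.coe_filter, Set.mem_ofPred_eq, Finset.mem_univ, true_and] at hi hj
              simp only at hij
              ext
              rw [← Nat.div_add_mod (i : ℕ) k, ← Nat.div_add_mod (j : ℕ) k, hij, hi.1, hj.1]
        _ = k := Finset.card_range k
    · simp
  have hsample : ∀ (i : Fin n) (τ : State), -(L : ℤ) ≤ τ.1 → τ.1 ≤ τmax → ∀ j < M,
      ∃ t < G * M * B, t / B / G = j ∧ i ∈ play t ∧ stateAt play t i = τ := by
    intro i τ hl hu j hj
    have hig : (i : ℕ) / k < G := by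
      have := Nat.div_le_div_right (c := k) i.2.le
      omega
    have hβ : G * j + i / k < G * M := by nlinarith
    have hlt : ∀ r < B, B * (G * j + i / k) + r < G * M * B := by
      intro r hr; nlinarith
    have hdiv : ∀ r < B, (B * (G * j + i / k) + r) / B = G * j + i / k := by
      intro r hr
      rw [Nat.mul_add_div hB0, Nat.div_eq_of_lt hr, add_zero]
    have hmem : ∀ r < B, (i ∈ play (B * (G * j + i / k) + r) ↔ blockPattern τmax r = true) := by
      intro r hr
      simp only [play, if_pos (hlt r hr), Finset.mem_filter, Finset.mem_univ, true_and, hdiv r hr,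
        Nat.mul_add_mod, Nat.mod_eq_of_lt hig, Nat.mod_eq_of_lt hr]
    obtain ⟨r, hr, hr1, hr2⟩ := exists_play_in_block hτ
      (b := fun r => decide (i ∈ play (B * (G * j + i / k) + r)))
      (stateAt play (B * (G * j + i / k)) i)
      (fun r hr => by rw [Bool.eq_iff_iff, decide_eq_true_eq]; exact hmem r hr) τ hl hu
    refine ⟨_, hlt r hr, ?_, of_decide_eq_true hr1, ?_⟩
    · rw [hdiv r hr, Nat.mul_add_div hG0, Nat.div_eq_of_lt hig, add_zero]
    · rw [stateAt_add]; exact hr2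
  let E : Exploration n k τmax L :=
    { N := G * M * B + τmax
      play := play
      card_le := fun t _ => hcard t
      covers := fun i τ hl hu => by
        obtain ⟨t, ht, -, h⟩ := hsample i τ hl hu 0 hM
        exact ⟨t, by omega, h⟩ }
  refine ⟨E, rfl, fun i τ hl hu => ?_, fun i => ?_⟩
  · choose! f hf1 hf2 hf3 using hsample i τ hl hu
    calc M = (Finset.range M).card := (Finset.card_range M).symm
      _ ≤ _ := by
        refine Finset.card_le_card_of_injOn f ?_ ?_
        · intro j hj
          have hj := Finset.mem_range.1 (Finset.mem_coe.1 hj)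
          refine Finset.mem_coe.2 (Finset.mem_filter.2 ⟨Finset.mem_range.2 ?_, hf3 j hj⟩)
          exact (hf1 j hj).trans_le (Nat.le_add_right _ _)
        · intro j hj j' hj' h
          rw [← hf2 j (Finset.mem_range.1 (Finset.mem_coe.1 hj)),
            ← hf2 j' (Finset.mem_range.1 (Finset.mem_coe.1 hj')), h]
  · show (τmax : ℤ) ≤ (stateAt play (G * M * B + τmax) i).1
    rw [stateAt_add]
    have h := armState_idle (b := fun j => decide (i ∈ play (G * M * B + j)))
      (stateAt play (G * M * B) i) (m := τmax - 1) (fun j _ => by simp [play])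
    rw [Nat.sub_add_cancel hτ] at h
    omega

end Exploration

/-! ### Robustness of the planning algorithm -/

section Robust

variable {n k τmax L : ℕ}

lemma plays_le_length (I : Interval τmax L) : I.plays ≤ I.length := by
  unfold Interval.plays Interval.length; omega

lemma LPFeasible.sum_plays_le_one {x : Fin n → Interval τmax L → ℝ} (hx : LPFeasible k τmax L x)
    (i : Fin n) : ∑ I : Interval τmax L, (I.plays : ℝ) * x i I ≤ 1 :=
  (Finset.sum_le_sum fun I _ => mul_le_mul_of_nonneg_right
    (by exact_mod_cast plays_le_length I) (hx.nonneg i I)).trans (hx.arm i)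

/-- The payoffs of an interval depend only on the states `-L, …, -1, 1, …, τmax`. -/
lemma aggPayoff_le_add (I : Interval τmax L) {q q' : State → ℝ} {δ : ℝ}
    (h : ∀ τ : State, -(L : ℤ) ≤ τ.1 → τ.1 ≤ τmax → q τ ≤ q' τ + δ) :
    I.aggPayoff q ≤ I.aggPayoff q' + I.plays * δ := by
  have h1 := I.1.2
  have h2 := I.2.2
  have hu : q I.u ≤ q' I.u + δ := by
    apply h <;> simp only [Interval.u, posState] <;> omega
  have hs : ∑ j ∈ Finset.range I.2, q (negState j)
      ≤ ∑ j ∈ Finset.range I.2, (q' (negState j) + δ) := by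
    refine Finset.sum_le_sum fun j hj => ?_
    rw [Finset.mem_range] at hj
    apply h <;> simp only [negState] <;> omega
  rw [Finset.sum_add_distrib, Finset.sum_const, Finset.card_range, nsmul_eq_mul] at hs
  simp only [Interval.aggPayoff, Interval.plays]
  push_cast
  linarith

/-- If the payoffs `ph` are `δ`-accurate for all arms outside the set `bad`, then the planning
algorithm run on `ph`, evaluated with the true payoffs `p` at its virtual states, loses at most
`2 (k δ + |bad|)` per round. -/
lemma gammaK_mul_lpValue_le_of_accurate (hk : 1 ≤ k) (c : Choices n k τmax L)
    {p ph : Fin n → State → ℝ} (hp0 : ∀ i τ, 0 ≤ p i τ) (hp1 : ∀ i τ, p i τ ≤ 1)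
    (hph0 : ∀ i τ, 0 ≤ ph i τ) (hph1 : ∀ i τ, ph i τ ≤ 1) {δ : ℝ} (hδ : 0 ≤ δ)
    (bad : Finset (Fin n))
    (hbad : ∀ i ∉ bad, ∀ τ : State, -(L : ℤ) ≤ τ.1 → τ.1 ≤ τmax → |ph i τ - p i τ| ≤ δ) (t : ℕ) :
    gammaK k * lpValue p (c.solve p) - 2 * (k * δ + bad.card)
      ≤ ∑ s : Seed n τmax L, seedProb (c.solve ph) s *
        ∑ i ∈ planPlay c ph s t, virtualPayoff p s t i := by
  classical
  have hk0 : (0 : ℝ) ≤ k := by positivity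
  have herr : ∀ i, ∀ τ : State, -(L : ℤ) ≤ τ.1 → τ.1 ≤ τmax →
      |ph i τ - p i τ| ≤ δ + if i ∈ bad then 1 else 0 := by
    intro i τ hl hu
    by_cases hi : i ∈ bad
    · rw [if_pos hi, abs_le]
      constructor <;> linarith [hp0 i τ, hp1 i τ, hph0 i τ, hph1 i τ]
    · simpa [hi] using hbad i hi τ hl hu
  have hx := (c.solve_optimal ph).1
  have hxs := (c.solve_optimal p).1
  have h1 := gammaK_mul_lpValue_le hk c ph t hph0 hph1
  have h2 : ∑ s : Seed n τmax L, seedProb (c.solve ph) s *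
        ∑ i ∈ planPlay c ph s t, virtualPayoff ph s t i - (k * δ + bad.card)
      ≤ ∑ s : Seed n τmax L, seedProb (c.solve ph) s *
        ∑ i ∈ planPlay c ph s t, virtualPayoff p s t i := by
    have h : ∑ s : Seed n τmax L, seedProb (c.solve ph) s * (k * δ + bad.card)
        = k * δ + bad.card := by rw [← Finset.sum_mul, sum_seedProb, one_mul]
    rw [← h, ← Finset.sum_sub_distrib]
    refine Finset.sum_le_sum fun s _ => ?_
    rw [← mul_sub]
    refine mul_le_mul_of_nonneg_left ?_ (seedProb_nonneg hx s)
    rw [sub_le_iff_le_add]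
    have h3 : ∑ i ∈ planPlay c ph s t, virtualPayoff ph s t i
        ≤ ∑ i ∈ planPlay c ph s t,
          (virtualPayoff p s t i + (δ + if i ∈ bad then 1 else 0)) := by
      refine Finset.sum_le_sum fun i hi => ?_
      have hc := (mem_candidates s t i).1 (c.pick_subset _ _ hi)
      rw [virtualPayoff_eq, virtualPayoff_eq]
      rcases hs : s i with _ | ⟨I, r⟩
      · rw [hs] at hc; simp [isCandidate] at hc
      · have hb := I.virtualState_bounds r t
        have := (abs_le.1 (herr i (virtualState I r t) hb.1 hb.2.1)).2
        simp only [seedValue]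
        linarith
    refine h3.trans ?_
    rw [Finset.sum_add_distrib, Finset.sum_add_distrib]
    have h4 : ∑ i ∈ planPlay c ph s t, δ ≤ k * δ := by
      rw [Finset.sum_const, nsmul_eq_mul]
      exact mul_le_mul_of_nonneg_right (by exact_mod_cast c.pick_card _ _) hδ
    have h5 : ∑ i ∈ planPlay c ph s t, (if i ∈ bad then (1 : ℝ) else 0) ≤ bad.card := by
      rw [Finset.sum_boole]
      exact_mod_cast Finset.card_le_card fun i hi => (Finset.mem_filter.1 hi).2
    linarith
  have h3 : lpValue p (c.solve p) ≤ lpValue ph (c.solve p) + (k * δ + bad.card) := by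
    have h4 : lpValue p (c.solve p) ≤ ∑ i, ∑ I : Interval τmax L,
        (I.aggPayoff (ph i) * c.solve p i I +
          (δ + if i ∈ bad then 1 else 0) * ((I.plays : ℝ) * c.solve p i I)) := by
      refine Finset.sum_le_sum fun i _ => Finset.sum_le_sum fun I _ => ?_
      have h := aggPayoff_le_add I (q := p i) (q' := ph i) (δ := δ + if i ∈ bad then 1 else 0)
        (fun τ hl hu => by have := (abs_le.1 (herr i τ hl hu)).1; linarith)
      nlinarith [mul_le_mul_of_nonneg_right h (hxs.nonneg i I)]
    simp only [Finset.sum_add_distrib, ← Finset.mul_sum, add_mul] at h4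
    have h5 : ∑ i, (if i ∈ bad then (1 : ℝ) else 0) *
        ∑ I : Interval τmax L, (I.plays : ℝ) * c.solve p i I ≤ bad.card := by
      have : ∀ i ∈ Finset.univ, (if i ∈ bad then (1 : ℝ) else 0) *
          ∑ I : Interval τmax L, (I.plays : ℝ) * c.solve p i I ≤ if i ∈ bad then 1 else 0 := by
        intro i _
        split_ifs
        · simpa using hxs.sum_plays_le_one i
        · simp
      refine (Finset.sum_le_sum this).trans ?_
      simp
    have h6 : δ * ∑ i, ∑ I : Interval τmax L, (I.plays : ℝ) * c.solve p i I ≤ δ * k :=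
      mul_le_mul_of_nonneg_left hxs.total hδ
    have h7 : ∑ i, ∑ I : Interval τmax L, I.aggPayoff (ph i) * c.solve p i I
      = lpValue ph (c.solve p) := rfl
    linarith
  have h4 := (c.solve_optimal ph).2 _ hxs
  have hg0 := gammaK_nonneg k
  have hg1 := gammaK_le_one k
  have h5 : gammaK k * lpValue p (c.solve p)
      ≤ gammaK k * lpValue ph (c.solve ph) + (k * δ + bad.card) := by
    have h6 : gammaK k * lpValue p (c.solve p)
        ≤ gammaK k * (lpValue ph (c.solve ph) + (k * δ + bad.card)) :=
      mul_le_mul_of_nonneg_left (by linarith) hg0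
    have h7 : gammaK k * (k * δ + bad.card) ≤ k * δ + bad.card :=
      mul_le_of_le_one_left (by positivity) hg1
    linarith
  linarith

end Robust

/-! ### Concentration of the empirical means -/

section Estimates

variable {n k τmax L : ℕ} {Ω : Type*} [MeasurableSpace Ω] {μ : Measure Ω}
  {p : Fin n → State → ℝ} {X : ℕ → Fin n → State → Ω → ℝ}

/-- Hoeffding's inequality for the empirical mean over a set of rounds. -/
lemma measureReal_empirical_mean_le [IsProbabilityMeasure μ] (hX : IsRewardModel μ p X) (i : Fin n) (τ : State)
    {S : Finset ℕ} {M : ℕ} (hM : 1 ≤ M) (hS : M ≤ S.card) {δ : ℝ} (hδ : 0 ≤ δ) :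
    μ.real {ω | δ < |(∑ t ∈ S, X t i τ ω) / (S.card : ℝ) - p i τ|}
      ≤ 2 * Real.exp (-(2 * M * δ ^ 2)) := by
  have hm : (0 : ℝ) < S.card := by exact_mod_cast (by omega : 0 < S.card)
  have hinj : Function.Injective fun t : ℕ => ((t, i, τ) : ℕ × Fin n × State) :=
    fun a b h => congrArg Prod.fst h
  have hind : iIndepFun (fun t ω => X t i τ ω - p i τ) μ :=
    (hX.indep.precomp hinj).comp (fun _ x => x - p i τ) fun _ => measurable_id.sub_const _
  have hind' : iIndepFun (fun t ω => -(X t i τ ω - p i τ)) μ :=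
    hind.comp (fun _ x => -x) fun _ => measurable_neg
  have hsub : ∀ t ∈ S, HasSubgaussianMGF (fun ω => X t i τ ω - p i τ)
      ((‖(1 : ℝ) - 0‖₊ / 2) ^ 2) μ := by
    intro t _
    have := hasSubgaussianMGF_of_mem_Icc (hX.measurable t i τ).aemeasurable (hX.mem_Icc t i τ)
    rwa [hX.mean] at this
  have h1 := HasSubgaussianMGF.measure_sum_ge_le_of_iIndepFun hind hsub
    (ε := S.card * δ) (by positivity)
  have h2 := HasSubgaussianMGF.measure_sum_ge_le_of_iIndepFun hind'
    (fun t ht => (hsub t ht).neg) (ε := S.card * δ) (by positivity)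
  have hexp : Real.exp (-(S.card * δ) ^ 2 /
      (2 * ((∑ _t ∈ S, (‖(1 : ℝ) - 0‖₊ / 2) ^ 2 : NNReal) : ℝ)))
      ≤ Real.exp (-(2 * M * δ ^ 2)) := by
    rw [Real.exp_le_exp]
    have h3 : -(S.card * δ) ^ 2 / (2 * ((∑ _t ∈ S, (‖(1 : ℝ) - 0‖₊ / 2) ^ 2 : NNReal) : ℝ))
        = -(2 * S.card * δ ^ 2) := by
      simp only [Finset.sum_const, nsmul_eq_mul]
      push_cast
      norm_num
      field_simp
      ring
    rw [h3, neg_le_neg_iff]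
    have : (M : ℝ) ≤ S.card := by exact_mod_cast hS
    gcongr
  have hsum : ∀ ω, (S.card : ℝ) * ((∑ t ∈ S, X t i τ ω) / (S.card : ℝ) - p i τ)
      = ∑ t ∈ S, (X t i τ ω - p i τ) := by
    intro ω
    rw [Finset.sum_sub_distrib, Finset.sum_const, nsmul_eq_mul]
    field_simp
  calc μ.real {ω | δ < |(∑ t ∈ S, X t i τ ω) / (S.card : ℝ) - p i τ|}
      ≤ μ.real ({ω | S.card * δ ≤ ∑ t ∈ S, (X t i τ ω - p i τ)} ∪
          {ω | S.card * δ ≤ ∑ t ∈ S, -(X t i τ ω - p i τ)}) := by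
        refine measureReal_mono fun ω hω => ?_
        have hω : δ < |(∑ t ∈ S, X t i τ ω) / (S.card : ℝ) - p i τ| := hω
        rcases lt_abs.1 hω with h | h
        · left
          show S.card * δ ≤ ∑ t ∈ S, (X t i τ ω - p i τ)
          rw [← hsum]
          exact mul_le_mul_of_nonneg_left h.le hm.le
        · right
          show S.card * δ ≤ ∑ t ∈ S, -(X t i τ ω - p i τ)
          rw [Finset.sum_neg_distrib, ← hsum, ← mul_neg]
          exact mul_le_mul_of_nonneg_left h.le hm.le
    _ ≤ _ := measureReal_union_le _ _
    _ ≤ _ := add_le_add (h1.trans hexp) (h2.trans hexp)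
    _ = _ := by ring

/-- The states `-L, …, -1, 1, …, τmax`. -/
def relevantStates (τmax L : ℕ) : Finset State :=
  (Finset.range τmax).image posState ∪ (Finset.range L).image negState

lemma mem_relevantStates {τ : State} :
    τ ∈ relevantStates τmax L ↔ -(L : ℤ) ≤ τ.1 ∧ τ.1 ≤ τmax := by
  simp only [relevantStates, Finset.mem_union, Finset.mem_image, Finset.mem_range]
  constructor
  · rintro (⟨m, hm, rfl⟩ | ⟨m, hm, rfl⟩) <;> simp only [posState, negState] <;> omega
  · rintro ⟨hl, hu⟩
    rcases exists_eq_posState_or_negState τ with ⟨m, rfl⟩ | ⟨m, rfl⟩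
    · exact Or.inl ⟨m, by simp only [posState] at hu; omega, rfl⟩
    · exact Or.inr ⟨m, by simp only [negState] at hl; omega, rfl⟩

lemma card_relevantStates_le : (relevantStates τmax L).card ≤ τmax + L :=
  (Finset.card_union_le _ _).trans
    (add_le_add (Finset.card_image_le.trans_eq (Finset.card_range _))
      (Finset.card_image_le.trans_eq (Finset.card_range _)))

/-- The event that some estimate of arm `i` is off by more than `δ`. -/
def badEvent (E : Exploration n k τmax L) (p : Fin n → State → ℝ)
    (X : ℕ → Fin n → State → Ω → ℝ) (δ : ℝ) (i : Fin n) : Set Ω :=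
  ⋃ τ ∈ relevantStates τmax L,
    {ω | δ < |E.estimate (fun t i τ => X t i τ ω) i τ - p i τ|}

lemma measurable_estimate {Ω : Type*} [MeasurableSpace Ω] (E : Exploration n k τmax L)
    {X : ℕ → Fin n → State → Ω → ℝ} (hX : ∀ t < E.N, ∀ i τ, Measurable (X t i τ)) :
    Measurable fun ω => E.estimate fun t i τ => X t i τ ω := by
  refine measurable_pi_lambda _ fun i => measurable_pi_lambda _ fun τ => ?_
  refine (Finset.measurable_sum _ fun t ht => ?_).div_const _
  exact hX t (Finset.mem_range.1 (Finset.mem_filter.1 ht).1) i τ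

lemma measurableSet_badEvent (hX : IsRewardModel μ p X) (E : Exploration n k τmax L) (δ : ℝ)
    (i : Fin n) : MeasurableSet (badEvent E p X δ i) := by
  refine Finset.measurableSet_biUnion _ fun τ _ => ?_
  refine measurableSet_lt measurable_const ?_
  have h := (measurable_apply_apply i τ).comp
    (measurable_estimate E fun t _ => hX.measurable t)
  exact continuous_abs.measurable.comp (h.sub_const _)

lemma measureReal_badEvent_le [IsProbabilityMeasure μ] (hX : IsRewardModel μ p X) (E : Exploration n k τmax L) {M : ℕ}
    (hM : 1 ≤ M)
    (hE : ∀ (i : Fin n) (τ : State), -(L : ℤ) ≤ τ.1 → τ.1 ≤ τmax → M ≤ (E.samples i τ).card)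
    {δ : ℝ} (hδ : 0 ≤ δ) (i : Fin n) :
    μ.real (badEvent E p X δ i) ≤ (τmax + L) * (2 * Real.exp (-(2 * M * δ ^ 2))) := by
  refine (measureReal_biUnion_finset_le _ _).trans ?_
  refine (Finset.sum_le_card_nsmul _ _ (2 * Real.exp (-(2 * M * δ ^ 2))) fun τ hτ => ?_).trans ?_
  · obtain ⟨hl, hu⟩ := mem_relevantStates.1 hτ
    exact measureReal_empirical_mean_le hX i τ hM (hE i τ hl hu) hδ
  · rw [nsmul_eq_mul]
    refine mul_le_mul_of_nonneg_right ?_ (by positivity)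
    exact_mod_cast card_relevantStates_le

lemma ae_estimate_mem_Icc (hX : IsRewardModel μ p X) (E : Exploration n k τmax L) :
    ∀ᵐ ω ∂μ, ∀ i τ, E.estimate (fun t i τ => X t i τ ω) i τ ∈ Set.Icc (0 : ℝ) 1 := by
  have h : ∀ᵐ ω ∂μ, ∀ t i τ, X t i τ ω ∈ Set.Icc (0 : ℝ) 1 := by
    simp only [ae_all_iff]
    exact hX.mem_Icc
  filter_upwards [h] with ω hω i τ
  refine ⟨div_nonneg (Finset.sum_nonneg fun t _ => (hω t i τ).1) (by positivity), ?_⟩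
  refine div_le_one_of_le₀ ?_ (by positivity)
  exact (Finset.sum_le_card_nsmul _ _ (1 : ℝ) fun t _ => (hω t i τ).2).trans (by simp)

/-- The estimates are independent of all payoffs after the exploration phase. -/
lemma indepFun_estimate (hX : IsRewardModel μ p X) (E : Exploration n k τmax L) {t : ℕ}
    (ht : E.N ≤ t) (i : Fin n) (τ : State) :
    IndepFun (fun ω => E.estimate fun t i τ => X t i τ ω) (X t i τ) μ := by
  let S : Set (ℕ × Fin n × State) := {j | j.1 < E.N}
  let m : ℕ × Fin n × State → MeasurableSpace Ω := fun j =>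
    MeasurableSpace.comap (X j.1 j.2.1 j.2.2) inferInstance
  have h := indep_iSup_of_disjoint (m := m) (S := S) (T := {(t, i, τ)})
    (fun j => (hX.measurable j.1 j.2.1 j.2.2).comap_le) hX.indep
    (by
      rw [Set.disjoint_singleton_right]
      exact fun h => absurd (show t < E.N from h) (by omega))
  rw [IndepFun_iff_Indep]
  refine indep_of_indep_of_le_left (indep_of_indep_of_le_right h ?_) ?_
  · exact le_iSup₂_of_le (f := fun j (_ : j ∈ ({(t, i, τ)} : Set (ℕ × Fin n × State))) => m j)
      (t, i, τ) rfl le_rfl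
  · rw [← measurable_iff_comap_le]
    refine @measurable_estimate _ _ _ _ _ (⨆ j ∈ S, m j) E X fun t ht i τ => ?_
    rw [measurable_iff_comap_le]
    exact le_iSup₂_of_le (f := fun j (_ : j ∈ S) => m j) (t, i, τ) ht le_rfl

end Estimates

/-! ### The expected payoff of Explore-then-Commit -/

section Payoff

variable {n k τmax L : ℕ}

lemma stateAt_mem_relevantStates (A : ℕ → Finset (Fin n)) (t : ℕ) (i : Fin n) :
    stateAt A t i ∈ relevantStates (t + 1) (t + 1) := by
  rw [mem_relevantStates]
  induction t with
  | zero => simp [stateAt, posState]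
  | succ t ih =>
    rw [stateAt, step_val]
    push_cast at ih ⊢
    have := (stateAt A t i).2
    split_ifs <;> omega

lemma measurable_seedProb_solve (c : Choices n k τmax L) (s : Seed n τmax L) :
    Measurable fun ph => seedProb (c.solve ph) s := by
  have hx : ∀ i I, Measurable fun ph => c.solve ph i I := fun i I =>
    measurable_pi_iff.1 (measurable_pi_iff.1 c.solve_measurable i) I
  simp only [seedProb_eq]
  refine Finset.measurable_prod _ fun i _ => ?_
  rcases s i with _ | ⟨I, r⟩
  · simp only [armWeight]
    exact measurable_const.sub (Finset.measurable_sum _ fun I _ => (hx i I).const_mul _)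
  · simp only [armWeight_some]
    exact hx i I

lemma measurable_virtualPayoff (s : Seed n τmax L) (t : ℕ) :
    Measurable fun ph : Fin n → State → ℝ => virtualPayoff ph s t := by
  refine measurable_pi_lambda _ fun i => ?_
  simp only [virtualPayoff_eq]
  rcases s i with _ | ⟨I, r⟩
  · exact measurable_const
  · exact measurable_apply_apply i _

lemma measurableSet_mem_etcPlay (E : Exploration n k τmax L) (c : Choices n k τmax L)
    (s : Seed n τmax L) (t : ℕ) (i : Fin n) : MeasurableSet {ph | i ∈ etcPlay E c ph s t} := by
  by_cases ht : t < E.N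
  · simp only [etcPlay, if_pos ht]
    exact MeasurableSet.const _
  · simp only [etcPlay, if_neg ht]
    have h : {ph | i ∈ planPlay c ph s (t - E.N + 1)} = ⋃ S ∈ {S : Finset (Fin n) | i ∈ S},
        (fun ph => virtualPayoff ph s (t - E.N + 1)) ⁻¹'
          {w | c.pick w (candidates s (t - E.N + 1)) = S} := by
      ext ph
      simp [planPlay]
    rw [h]
    exact MeasurableSet.biUnion (Set.to_countable _) fun S _ =>
      measurable_virtualPayoff s _ (c.pick_measurable _ S)

lemma measurable_stateAt_etcPlay (E : Exploration n k τmax L) (c : Choices n k τmax L)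
    (s : Seed n τmax L) (t : ℕ) (i : Fin n) :
    Measurable fun ph => stateAt (etcPlay E c ph s) t i := by
  induction t with
  | zero => exact measurable_const
  | succ t ih =>
    have h1 : Measurable fun ph => decide (i ∈ etcPlay E c ph s t) :=
      measurable_to_bool (by
        convert measurableSet_mem_etcPlay E c s t i using 1
        ext ph; simp)
    have h2 : Measurable fun z : Bool × State => step z.1 z.2 := measurable_of_countable _
    exact h2.comp (h1.prodMk ih)

/-- The payoff of round `t`, in expectation over the seed, if the algorithm has the estimates `ph`
and the payoffs of round `t` are `Y`. -/
def roundPayoff (E : Exploration n k τmax L) (c : Choices n k τmax L) (ph Y : Fin n → State → ℝ)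
    (t : ℕ) : ℝ :=
  ∑ s : Seed n τmax L, seedProb (c.solve ph) s *
    ∑ i ∈ etcPlay E c ph s t, Y i (stateAt (etcPlay E c ph s) t i)

open Classical in
/-- The probability that the seed is `s` if this makes the algorithm play arm `i` at state `τ` in
round `t`, and `0` otherwise. -/
def playWeight (E : Exploration n k τmax L) (c : Choices n k τmax L) (t : ℕ) (s : Seed n τmax L)
    (i : Fin n) (τ : State) (ph : Fin n → State → ℝ) : ℝ :=
  seedProb (c.solve ph) s *
    if i ∈ etcPlay E c ph s t ∧ stateAt (etcPlay E c ph s) t i = τ then 1 else 0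

lemma measurable_playWeight (E : Exploration n k τmax L) (c : Choices n k τmax L) (t : ℕ)
    (s : Seed n τmax L) (i : Fin n) (τ : State) : Measurable (playWeight E c t s i τ) := by
  refine (measurable_seedProb_solve c s).mul (Measurable.ite ?_ measurable_const measurable_const)
  exact (measurableSet_mem_etcPlay E c s t i).inter
    (measurable_stateAt_etcPlay E c s t i (measurableSet_singleton τ))

lemma abs_playWeight_le_one (E : Exploration n k τmax L) (c : Choices n k τmax L) (t : ℕ)
    (s : Seed n τmax L) (i : Fin n) (τ : State) (ph : Fin n → State → ℝ) :
    |playWeight E c t s i τ ph| ≤ 1 := by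
  have h0 := fun s => seedProb_nonneg (c.solve_optimal ph).1 s
  have h1 : seedProb (c.solve ph) s ≤ 1 :=
    (Finset.single_le_sum (fun s _ => h0 s) (Finset.mem_univ s)).trans_eq (sum_seedProb _)
  have h2 := h0 s
  unfold playWeight
  split_ifs
  · rw [mul_one, abs_of_nonneg h2]; exact h1
  · simp

/-- Splitting the payoff of a round by the state of the played arm makes it linear in `Y`, with
weights that depend only on the estimates. -/
lemma roundPayoff_eq (E : Exploration n k τmax L) (c : Choices n k τmax L)
    (ph Y : Fin n → State → ℝ) (t : ℕ) :
    roundPayoff E c ph Y t = ∑ s : Seed n τmax L, ∑ i, ∑ τ ∈ relevantStates (t + 1) (t + 1),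
      playWeight E c t s i τ ph * Y i τ := by
  classical
  refine Finset.sum_congr rfl fun s _ => ?_
  rw [Finset.mul_sum, ← Finset.sum_filter_add_sum_filter_not Finset.univ
    (fun i => i ∈ etcPlay E c ph s t), Finset.filter_univ_mem]
  have h0 : ∑ i with ¬ i ∈ etcPlay E c ph s t, ∑ τ ∈ relevantStates (t + 1) (t + 1),
      playWeight E c t s i τ ph * Y i τ = 0 := by
    refine Finset.sum_eq_zero fun i hi => Finset.sum_eq_zero fun τ _ => ?_
    simp [playWeight, (Finset.mem_filter.1 hi).2]
  rw [h0, add_zero]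
  refine Finset.sum_congr rfl fun i hi => ?_
  rw [Finset.sum_eq_single_of_mem _ (stateAt_mem_relevantStates (etcPlay E c ph s) t i)]
  · simp [playWeight, hi]
  · intro τ _ hτ
    simp [playWeight, hτ.symm]

lemma roundPayoff_nonneg (E : Exploration n k τmax L) (c : Choices n k τmax L)
    {ph Y : Fin n → State → ℝ} (hY : ∀ i τ, 0 ≤ Y i τ) (t : ℕ) : 0 ≤ roundPayoff E c ph Y t :=
  Finset.sum_nonneg fun s _ => mul_nonneg (seedProb_nonneg (c.solve_optimal ph).1 s)
    (Finset.sum_nonneg fun _ _ => hY _ _)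

/-- After an exploration phase that leaves all arms in states at least `τmax`, every round with
estimates that are `δ`-accurate outside `bad` collects almost `γ_k` times the value of the linear
program. -/
lemma gammaK_mul_lpValue_le_roundPayoff (hk : 1 ≤ k) (E : Exploration n k τmax L)
    (c : Choices n k τmax L) (hE : ∀ i, (τmax : ℤ) ≤ (stateAt E.play E.N i).1)
    {p ph : Fin n → State → ℝ} (hp : IsPayoff τmax p)
    (hph0 : ∀ i τ, 0 ≤ ph i τ) (hph1 : ∀ i τ, ph i τ ≤ 1) {δ : ℝ} (hδ : 0 ≤ δ)
    (bad : Finset (Fin n))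
    (hbad : ∀ i ∉ bad, ∀ τ : State, -(L : ℤ) ≤ τ.1 → τ.1 ≤ τmax → |ph i τ - p i τ| ≤ δ)
    {t : ℕ} (ht : E.N ≤ t) :
    gammaK k * lpValue p (c.solve p) - 2 * (k * δ + bad.card) ≤ roundPayoff E c ph p t := by
  obtain ⟨j, rfl⟩ := Nat.exists_eq_add_of_le ht
  refine (gammaK_mul_lpValue_le_of_accurate hk c hp.nonneg hp.le_one hph0 hph1 hδ bad hbad
    (j + 1)).trans ?_
  refine Finset.sum_le_sum fun s _ => mul_le_mul_of_nonneg_left ?_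
    (seedProb_nonneg (c.solve_optimal ph).1 s)
  have hplan : ∀ j, etcPlay E c ph s (E.N + j) = planPlay c ph s (j + 1) := fun j => by
    simp [etcPlay]
  rw [hplan]
  refine Finset.sum_le_sum fun i hi => ?_
  have hN : ∀ m ≤ E.N, stateAt (etcPlay E c ph s) m i = stateAt E.play m i := by
    intro m hm
    induction m with
    | zero => rfl
    | succ m ih =>
      have h : etcPlay E c ph s m = E.play m := if_pos (by omega)
      show step (decide (i ∈ etcPlay E c ph s m)) (stateAt (etcPlay E c ph s) m i)
        = step (decide (i ∈ E.play m)) (stateAt E.play m i)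
      rw [ih (by omega), h]
  have hc := (mem_candidates s (j + 1) i).1 (c.pick_subset _ _ hi)
  rw [virtualPayoff_eq]
  rcases hs : s i with _ | ⟨I, r⟩
  · exact hp.nonneg _ _
  · refine hp.mono i (virtualState_le_stateAt (etcPlay E c ph s) s E.N (fun j => ?_) ?_ hs j)
    · rw [hplan]; exact c.pick_subset _ _
    · rw [hN _ le_rfl]; exact hE i

variable {Ω : Type*} [MeasurableSpace Ω] {μ : Measure Ω}
  {p : Fin n → State → ℝ} {X : ℕ → Fin n → State → Ω → ℝ}

lemma integrable_playWeight [IsProbabilityMeasure μ] (hX : IsRewardModel μ p X) (E : Exploration n k τmax L)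
    (c : Choices n k τmax L) (t : ℕ) (s : Seed n τmax L) (i : Fin n) (τ : State) :
    Integrable (fun ω => playWeight E c t s i τ (E.estimate fun t i τ => X t i τ ω)) μ :=
  Integrable.of_bound ((measurable_playWeight E c t s i τ).comp
    (measurable_estimate E fun t _ => hX.measurable t)).aestronglyMeasurable 1
    (Filter.Eventually.of_forall fun _ => abs_playWeight_le_one E c t s i τ _)

lemma integrable_playWeight_mul [IsProbabilityMeasure μ] (hX : IsRewardModel μ p X) (E : Exploration n k τmax L)
    (c : Choices n k τmax L) (t : ℕ) (s : Seed n τmax L) (i : Fin n) (τ : State) :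
    Integrable (fun ω => playWeight E c t s i τ (E.estimate fun t i τ => X t i τ ω) * X t i τ ω)
      μ :=
  (Integrable.of_mem_Icc 0 1 (hX.measurable t i τ).aemeasurable (hX.mem_Icc t i τ)).bdd_mul
    (c := 1) (integrable_playWeight hX E c t s i τ).aestronglyMeasurable
    (Filter.Eventually.of_forall fun _ => abs_playWeight_le_one E c t s i τ _)

lemma integrable_roundPayoff [IsProbabilityMeasure μ] (hX : IsRewardModel μ p X) (E : Exploration n k τmax L)
    (c : Choices n k τmax L) (t : ℕ) :
    Integrable (fun ω => roundPayoff E c (E.estimate fun t i τ => X t i τ ω)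
      (fun i τ => X t i τ ω) t) μ := by
  simp only [roundPayoff_eq]
  exact integrable_finsetSum _ fun s _ => integrable_finsetSum _ fun i _ =>
    integrable_finsetSum _ fun τ _ => integrable_playWeight_mul hX E c t s i τ

lemma integrable_roundPayoff_mean [IsProbabilityMeasure μ] (hX : IsRewardModel μ p X) (E : Exploration n k τmax L)
    (c : Choices n k τmax L) (t : ℕ) :
    Integrable (fun ω => roundPayoff E c (E.estimate fun t i τ => X t i τ ω) p t) μ := by
  simp only [roundPayoff_eq]
  exact integrable_finsetSum _ fun s _ => integrable_finsetSum _ fun i _ =>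
    integrable_finsetSum _ fun τ _ => (integrable_playWeight hX E c t s i τ).mul_const _

/-- After the exploration phase, payoffs can be replaced by their means: the choices depend on the
exploration payoffs only, which are independent of the payoffs of later rounds. -/
lemma integral_roundPayoff [IsProbabilityMeasure μ] (hX : IsRewardModel μ p X) (E : Exploration n k τmax L)
    (c : Choices n k τmax L) {t : ℕ} (ht : E.N ≤ t) :
    ∫ ω, roundPayoff E c (E.estimate fun t i τ => X t i τ ω) (fun i τ => X t i τ ω) t ∂μ
      = ∫ ω, roundPayoff E c (E.estimate fun t i τ => X t i τ ω) p t ∂μ := by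
  simp only [roundPayoff_eq]
  rw [integral_finsetSum _ fun s _ => integrable_finsetSum _ fun i _ =>
      integrable_finsetSum _ fun τ _ => integrable_playWeight_mul hX E c t s i τ,
    integral_finsetSum _ fun s _ => integrable_finsetSum _ fun i _ =>
      integrable_finsetSum _ fun τ _ => (integrable_playWeight hX E c t s i τ).mul_const _]
  refine Finset.sum_congr rfl fun s _ => ?_
  rw [integral_finsetSum _ fun i _ =>
      integrable_finsetSum _ fun τ _ => integrable_playWeight_mul hX E c t s i τ,
    integral_finsetSum _ fun i _ =>
      integrable_finsetSum _ fun τ _ => (integrable_playWeight hX E c t s i τ).mul_const _]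
  refine Finset.sum_congr rfl fun i _ => ?_
  rw [integral_finsetSum _ fun τ _ => integrable_playWeight_mul hX E c t s i τ,
    integral_finsetSum _ fun τ _ => (integrable_playWeight hX E c t s i τ).mul_const _]
  refine Finset.sum_congr rfl fun τ _ => ?_
  have hind : IndepFun (fun ω => playWeight E c t s i τ (E.estimate fun t i τ => X t i τ ω))
      (X t i τ) μ :=
    (indepFun_estimate hX E ht i τ).comp (measurable_playWeight E c t s i τ) measurable_id
  rw [hind.integral_fun_mul_eq_mul_integral
    (integrable_playWeight hX E c t s i τ).aestronglyMeasurable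
    (hX.measurable t i τ).aestronglyMeasurable, hX.mean, integral_mul_const]

lemma etcPayoff_eq [IsProbabilityMeasure μ] (hX : IsRewardModel μ p X) (E : Exploration n k τmax L)
    (c : Choices n k τmax L) (T : ℕ) :
    etcPayoff μ X E c T = ∑ t ∈ Finset.range T,
      ∫ ω, roundPayoff E c (E.estimate fun t i τ => X t i τ ω) (fun i τ => X t i τ ω) t ∂μ := by
  rw [← integral_finsetSum _ fun t _ => integrable_roundPayoff hX E c t]
  refine integral_congr_ae (Filter.Eventually.of_forall fun ω => ?_)
  simp only [etcRealized, roundPayoff, Finset.mul_sum]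
  rw [Finset.sum_comm]

lemma integral_roundPayoff_nonneg (hX : IsRewardModel μ p X) (E : Exploration n k τmax L)
    (c : Choices n k τmax L) (t : ℕ) :
    0 ≤ ∫ ω, roundPayoff E c (E.estimate fun t i τ => X t i τ ω) (fun i τ => X t i τ ω) t ∂μ := by
  have h : ∀ᵐ ω ∂μ, ∀ i τ, X t i τ ω ∈ Set.Icc (0 : ℝ) 1 := by
    simp only [ae_all_iff]
    exact hX.mem_Icc t
  refine integral_nonneg_of_ae ?_
  filter_upwards [h] with ω hω
  exact roundPayoff_nonneg E c (fun i τ => (hω i τ).1) t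

/-- The expected payoff of a round after the exploration phase: an arm with an inaccurate estimate
is charged with its probability, so that no union bound over the arms is needed. -/
lemma le_integral_roundPayoff [IsProbabilityMeasure μ] (hk : 1 ≤ k) (hX : IsRewardModel μ p X) (hp : IsPayoff τmax p)
    (E : Exploration n k τmax L) (c : Choices n k τmax L)
    (hE : ∀ i, (τmax : ℤ) ≤ (stateAt E.play E.N i).1) {δ : ℝ} (hδ : 0 ≤ δ) {t : ℕ}
    (ht : E.N ≤ t) :
    gammaK k * lpValue p (c.solve p) - 2 * (k * δ + ∑ i, μ.real (badEvent E p X δ i))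
      ≤ ∫ ω, roundPayoff E c (E.estimate fun t i τ => X t i τ ω) (fun i τ => X t i τ ω) t ∂μ := by
  classical
  rw [integral_roundPayoff hX E c ht]
  have hbi : ∀ i, Integrable ((badEvent E p X δ i).indicator (1 : Ω → ℝ)) μ := fun i =>
    (integrable_const (1 : ℝ)).indicator (measurableSet_badEvent hX E δ i)
  have hbs : Integrable (fun ω => ∑ i, (badEvent E p X δ i).indicator (1 : Ω → ℝ) ω) μ :=
    integrable_finsetSum _ fun i _ => hbi i
  have hbk : Integrable (fun ω => 2 * (k * δ +
      ∑ i, (badEvent E p X δ i).indicator (1 : Ω → ℝ) ω)) μ :=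
    ((integrable_const _).add hbs).const_mul _
  have h1 : gammaK k * lpValue p (c.solve p) - 2 * (k * δ + ∑ i, μ.real (badEvent E p X δ i))
      = ∫ ω, (gammaK k * lpValue p (c.solve p)
        - 2 * (k * δ + ∑ i, (badEvent E p X δ i).indicator (1 : Ω → ℝ) ω)) ∂μ := by
    rw [integral_sub (integrable_const _) hbk, integral_const_mul (2 : ℝ),
      integral_add (integrable_const _) hbs,
      integral_finsetSum _ fun i _ => hbi i]
    simp [integral_indicator_one (measurableSet_badEvent hX E δ _)]
  rw [h1]
  refine integral_mono_ae ((integrable_const _).sub hbk) (integrable_roundPayoff_mean hX E c t) ?_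
  filter_upwards [ae_estimate_mem_Icc hX E] with ω hω
  have h2 := gammaK_mul_lpValue_le_roundPayoff hk E c hE hp (fun i τ => (hω i τ).1)
    (fun i τ => (hω i τ).2) hδ (Finset.univ.filter fun i => ω ∈ badEvent E p X δ i)
    (fun i hi τ hl hu => by
      by_contra! hlt
      refine hi (Finset.mem_filter.2 ⟨Finset.mem_univ _, ?_⟩)
      exact Set.mem_biUnion (mem_relevantStates.2 ⟨hl, hu⟩) hlt) ht
  refine le_trans (le_of_eq ?_) h2
  simp [Set.indicator_apply]

/-- The regret of Explore-then-Commit: exploration, estimation errors, and large deviations. -/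
lemma etcRegret_le [IsProbabilityMeasure μ] (hk : 1 ≤ k) (hτ : 1 ≤ τmax) {ε : ℝ} (hε0 : 0 < ε) (hε : ε < 1)
    (hL : 1 ≤ L) (hεL : 1 ≤ ε * L) (hX : IsRewardModel μ p X) (hp : IsPayoff τmax p)
    (E : Exploration n k τmax L) (c : Choices n k τmax L)
    (hE : ∀ i, (τmax : ℤ) ≤ (stateAt E.play E.N i).1) {M : ℕ} (hM : 1 ≤ M)
    (hEM : ∀ (i : Fin n) (τ : State), -(L : ℤ) ≤ τ.1 → τ.1 ≤ τmax → M ≤ (E.samples i τ).card)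
    {δ : ℝ} (hδ : 0 ≤ δ) (T : ℕ) :
    etcRegret μ ε p X E c T ≤ k + k * E.N + T * (2 * (k * δ +
      n * ((τmax + L) * (2 * Real.exp (-(2 * M * δ ^ 2)))))) := by
  set V := lpValue p (c.solve p) with hV
  set F : ℝ := n * ((τmax + L) * (2 * Real.exp (-(2 * M * δ ^ 2)))) with hF
  have hV0 : 0 ≤ V := lpValue_nonneg hp.nonneg (c.solve_optimal p).1
  have hVk : V ≤ k := lpValue_le hp.le_one (c.solve_optimal p).1
  have hg0 := gammaK_nonneg k
  have hg1 := gammaK_le_one k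
  have hgV : gammaK k * V ≤ k := (mul_le_of_le_one_left hV0 hg1).trans hVk
  have hF0 : 0 ≤ F := by positivity
  have hkδ : 0 ≤ k * δ := by positivity
  have hbad : ∑ i, μ.real (badEvent E p X δ i) ≤ F := by
    refine (Finset.sum_le_card_nsmul _ _ _ fun i _ =>
      measureReal_badEvent_le hX E hM hEM hδ i).trans ?_
    simp [hF]
  have hround : ∀ t ∈ Finset.range T,
      gammaK k * V - 2 * (k * δ + F) - (if t < E.N then (k : ℝ) else 0)
      ≤ ∫ ω, roundPayoff E c (E.estimate fun t i τ => X t i τ ω) (fun i τ => X t i τ ω) t ∂μ := by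
    intro t _
    split_ifs with ht
    · have := integral_roundPayoff_nonneg hX E c t
      linarith
    · have := le_integral_roundPayoff hk hX hp E c hE hδ (not_lt.1 ht)
      linarith
  have hsum := Finset.sum_le_sum hround
  rw [← etcPayoff_eq hX E c T, Finset.sum_sub_distrib, Finset.sum_const, Finset.card_range,
    nsmul_eq_mul] at hsum
  have hN : ∑ t ∈ Finset.range T, (if t < E.N then (k : ℝ) else 0) ≤ k * E.N := by
    rw [← Finset.sum_filter, Finset.sum_const, nsmul_eq_mul, mul_comm]
    refine mul_le_mul_of_nonneg_left ?_ (by positivity)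
    have : ((Finset.range T).filter fun t => t < E.N).card ≤ (Finset.range E.N).card :=
      Finset.card_le_card fun t ht => Finset.mem_range.2 (Finset.mem_filter.1 ht).2
    rw [Finset.card_range] at this
    exact_mod_cast this
  have hopt := mul_opt_le_lpValue hL hτ hp (ρ := 1 - ε) (by linarith) (by nlinarith)
    (c.solve_optimal p) T
  have hopt' := mul_le_mul_of_nonneg_left hopt hg0
  unfold etcRegret
  nlinarith

lemma etcRegret_le_mul [IsProbabilityMeasure μ] (hX : IsRewardModel μ p X) (hp : IsPayoff τmax p)
    (E : Exploration n k τmax L) (c : Choices n k τmax L) {ε : ℝ} (hε0 : 0 ≤ ε) (hε : ε ≤ 1)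
    (T : ℕ) : etcRegret μ ε p X E c T ≤ k * T := by
  have h0 : 0 ≤ etcPayoff μ X E c T := by
    rw [etcPayoff_eq hX]
    exact Finset.sum_nonneg fun t _ => integral_roundPayoff_nonneg hX E c t
  have h1 := opt_le (k := k) hp.le_one T
  have h2 : (1 - ε) * gammaK k ≤ 1 :=
    mul_le_one₀ (by linarith) (gammaK_nonneg k) (gammaK_le_one k)
  have h3 : 0 ≤ (1 - ε) * gammaK k := mul_nonneg (by linarith) (gammaK_nonneg k)
  have h4 : (1 - ε) * gammaK k * opt k p T ≤ 1 * (T * k) :=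
    (mul_le_mul_of_nonneg_left h1 h3).trans
      (mul_le_mul_of_nonneg_right h2 (by positivity))
  unfold etcRegret
  linarith

end Payoff

/-! ### Balancing exploration and estimation -/

lemma rpow_one_third_pow_three {x : ℝ} (hx : 0 ≤ x) : (x ^ (1 / 3 : ℝ)) ^ 3 = x := by
  rw [← Real.rpow_natCast, ← Real.rpow_mul hx]
  norm_num

lemma rpow_two_thirds {x : ℝ} (hx : 0 ≤ x) : x ^ (2 / 3 : ℝ) = (x ^ (1 / 3 : ℝ)) ^ 2 := by
  rw [← Real.rpow_natCast, ← Real.rpow_mul hx]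
  norm_num

/-- The cost of the exploration phase with `(n / k + 1) M` blocks. -/
lemma exploration_cost_le {n k τmax M : ℕ} {L e D B : ℝ} (hkn : k ≤ n) (hτ : 1 ≤ τmax)
    (hL0 : 0 ≤ L) (hL : L ≤ 2 * e) (hD : D = (τmax : ℝ) ^ 2 + e) (hB : n * D * M ≤ B) :
    (k : ℝ) * ((((n / k : ℕ) : ℝ) + 1) * M * (((τmax : ℝ) + 2) * τmax + L) + τmax)
      ≤ 6 * B + k * τmax := by
  have hτ' : (1 : ℝ) ≤ τmax := by exact_mod_cast hτ
  have hkn' : (k : ℝ) ≤ n := by exact_mod_cast hkn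
  have h1 : ((n / k : ℕ) : ℝ) * k ≤ n := by exact_mod_cast Nat.div_mul_le_self n k
  have h2 : ((τmax : ℝ) + 2) * τmax + L ≤ 3 * D := by
    have := mul_le_mul_of_nonneg_right hτ' (by positivity : (0 : ℝ) ≤ τmax)
    rw [hD]
    linarith
  have h4 : (k : ℝ) * (((n / k : ℕ) : ℝ) + 1) ≤ 2 * n := by linarith
  have h5 : (k : ℝ) * (((n / k : ℕ) : ℝ) + 1) * (((τmax : ℝ) + 2) * τmax + L)
      ≤ 2 * n * (3 * D) := mul_le_mul h4 h2 (by positivity) (by positivity)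
  have h6 := mul_le_mul_of_nonneg_right h5 (by positivity : (0 : ℝ) ≤ M)
  linarith

/-- The probability bound `1 / y²` per state, with `y ≥ (τmax + L) T / 2`, pays for all rounds. -/
lemma deviation_cost_le {N y z p T : ℝ} (hN : 0 ≤ N) (hT : 0 ≤ T) (hz : 0 ≤ z) (hy : 2 ≤ y)
    (hzT : z * T ≤ 2 * y) (hp : p ≤ 1 / y ^ 2) : T * (N * (z * (2 * p))) ≤ 2 * N := by
  have hy0 : 0 < y := by linarith
  calc T * (N * (z * (2 * p))) = 2 * N * (z * T * p) := by ring
    _ ≤ 2 * N * (z * T * (1 / y ^ 2)) := by gcongr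
    _ ≤ 2 * N * (2 * y * (1 / y ^ 2)) := by gcongr
    _ = 2 * N * (2 / y) := by field_simp
    _ ≤ 2 * N * 1 := by
      refine mul_le_mul_of_nonneg_left ?_ (by positivity)
      rw [div_le_one hy0]
      exact hy
    _ = 2 * N := by ring

/-- If a single exploration pass, of cost about `n D = b³`, is already more expensive than the
intended bound `a² b c`, then the trivial regret bound `k T = a³` suffices. -/
lemma pow_three_le_of_lt {a b c : ℝ} (ha : 0 < a) (hb : 0 < b) (hc : 0 < c)
    (hc3 : 1 / 2 ≤ c ^ 3) (h : a ^ 2 * b * c < b ^ 3) : a ^ 3 ≤ 2 * (a ^ 2 * b * c) := by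
  have h2 : a ^ 2 * c < b ^ 2 := by
    refine lt_of_mul_lt_mul_right ?_ hb.le
    linarith [(by ring : b ^ 2 * b = b ^ 3), (by ring : a ^ 2 * c * b = a ^ 2 * b * c)]
  have h3 : a ≤ 2 * b * c := by
    refine le_of_sq_le_sq ?_ (by positivity)
    have h4 : a ^ 2 * c * c ^ 2 ≤ b ^ 2 * c ^ 2 :=
      mul_le_mul_of_nonneg_right h2.le (by positivity)
    have h5 : a ^ 2 * (1 / 2) ≤ a ^ 2 * c ^ 3 :=
      mul_le_mul_of_nonneg_left hc3 (by positivity)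
    have h6 : 0 ≤ b ^ 2 * c ^ 2 := by positivity
    calc a ^ 2 ≤ 2 * (b ^ 2 * c ^ 2) := by linarith [(by ring : a ^ 2 * c * c ^ 2 = a ^ 2 * c ^ 3)]
      _ ≤ 4 * (b ^ 2 * c ^ 2) := by linarith
      _ = (2 * b * c) ^ 2 := by ring
  calc a ^ 3 = a ^ 2 * a := by ring
    _ ≤ a ^ 2 * (2 * b * c) := mul_le_mul_of_nonneg_left h3 (by positivity)
    _ = _ := by ring

end MLSD

end

theorem theorem2 :
    ∃ K : ℝ, 0 < K ∧
      ∀ (n k τmax : ℕ), 1 ≤ k → k < n → 1 ≤ τmax →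
      ∀ ε : ℝ, 0 < ε → ε < 1 →
      ∀ T : ℕ, 1 ≤ T →
        Nonempty (MLSD.Choices n k τmax ⌈1 / ε⌉₊) ∧
        ∃ E : MLSD.Exploration n k τmax ⌈1 / ε⌉₊,
          ∀ (c : MLSD.Choices n k τmax ⌈1 / ε⌉₊)
            (p : Fin n → MLSD.State → ℝ), MLSD.IsPayoff τmax p →
          ∀ (Ω : Type*) [MeasurableSpace Ω] (μ : Measure Ω) [IsProbabilityMeasure μ]
            (X : ℕ → Fin n → MLSD.State → Ω → ℝ), MLSD.IsRewardModel μ p X →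
            MLSD.etcRegret μ ε p X E c T ≤
              K * ((n : ℝ) ^ (1 / 3 : ℝ) * (k : ℝ) ^ (2 / 3 : ℝ)
                    * ((τmax : ℝ) ^ 2 + 1 / ε) ^ (1 / 3 : ℝ)
                    * (Real.log (((τmax : ℝ) + 1 / ε) * (T : ℝ))) ^ (1 / 3 : ℝ)
                    * (T : ℝ) ^ (2 / 3 : ℝ)
                  + (k : ℝ) * (τmax : ℝ) + (n : ℝ)) := by
  refine ⟨14, by norm_num, fun n k τmax hk hkn hτ ε hε0 hε1 T hT =>
    ⟨MLSD.nonempty_choices _ _ _ _, ?_⟩⟩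
  set L := ⌈1 / ε⌉₊ with hL
  set D : ℝ := (τmax : ℝ) ^ 2 + 1 / ε with hD
  set y : ℝ := ((τmax : ℝ) + 1 / ε) * T with hy
  have hk' : (1 : ℝ) ≤ k := by exact_mod_cast hk
  have hkn' : (k : ℝ) ≤ n := by exact_mod_cast hkn.le
  have hτ' : (1 : ℝ) ≤ τmax := by exact_mod_cast hτ
  have hT' : (1 : ℝ) ≤ T := by exact_mod_cast hT
  have hε' : 1 < 1 / ε := by rw [lt_div_iff₀ hε0]; linarith
  have hLε : 1 / ε ≤ L := Nat.le_ceil _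
  have hL2 : (L : ℝ) ≤ 2 * (1 / ε) := by
    have := Nat.ceil_lt_add_one (by linarith : 0 ≤ 1 / ε)
    linarith
  have hL1 : 1 ≤ L := by
    have : (1 : ℝ) < L := hε'.trans_le hLε
    exact_mod_cast this.le
  have hy2 : 2 ≤ y := by
    calc (2 : ℝ) ≤ ((τmax : ℝ) + 1 / ε) * 1 := by linarith
      _ ≤ y := mul_le_mul_of_nonneg_left hT' (by linarith)
  have hlog : 1 / 2 ≤ Real.log y :=
    (by linarith [Real.log_two_gt_d9] : 1 / 2 ≤ Real.log 2).trans
      (Real.log_le_log (by norm_num) hy2)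
  -- All quantities are expressed by the cube roots `a`, `b`, `c` of `k T`, `n D` and the logarithm.
  obtain ⟨a, ha⟩ : ∃ a : ℝ, a = (k : ℝ) ^ (1 / 3 : ℝ) * (T : ℝ) ^ (1 / 3 : ℝ) := ⟨_, rfl⟩
  obtain ⟨b, hb⟩ : ∃ b : ℝ, b = (n : ℝ) ^ (1 / 3 : ℝ) * D ^ (1 / 3 : ℝ) := ⟨_, rfl⟩
  obtain ⟨c, hc⟩ : ∃ c : ℝ, c = Real.log y ^ (1 / 3 : ℝ) := ⟨_, rfl⟩
  have hn0 : (0 : ℝ) < n := by linarith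
  have hD0 : 0 < D := by positivity
  have ha0 : 0 < a := by rw [ha]; positivity
  have hb0 : 0 < b := by rw [hb]; positivity
  have hc0 : 0 < c := by rw [hc]; exact Real.rpow_pos_of_pos (by linarith) _
  have ha3 : a ^ 3 = k * T := by
    rw [ha, mul_pow, MLSD.rpow_one_third_pow_three (by linarith),
      MLSD.rpow_one_third_pow_three (by linarith)]
  have hb3 : b ^ 3 = n * D := by
    rw [hb, mul_pow, MLSD.rpow_one_third_pow_three hn0.le,
      MLSD.rpow_one_third_pow_three hD0.le]
  have hc3 : c ^ 3 = Real.log y := by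
    rw [hc, MLSD.rpow_one_third_pow_three (by linarith)]
  have hQ : (n : ℝ) ^ (1 / 3 : ℝ) * (k : ℝ) ^ (2 / 3 : ℝ) * D ^ (1 / 3 : ℝ)
      * (Real.log y) ^ (1 / 3 : ℝ) * (T : ℝ) ^ (2 / 3 : ℝ) = a ^ 2 * b * c := by
    rw [MLSD.rpow_two_thirds (by linarith), MLSD.rpow_two_thirds (by linarith), ha, hb, hc]
    ring
  rw [hQ]
  -- The number `M` of samples balances the exploration cost `b³ M` and the estimation cost `a³ δ`.
  set M := ⌈a ^ 2 * c / b ^ 2⌉₊ with hM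
  obtain ⟨δ, hδ⟩ : ∃ δ : ℝ, δ = c * b / a := ⟨_, rfl⟩
  have hδ0 : 0 ≤ δ := by rw [hδ]; positivity
  have hM0 : 1 ≤ M := Nat.one_le_ceil_iff.2 (by positivity)
  have hM1 : a ^ 2 * c / b ^ 2 ≤ M := Nat.le_ceil _
  have hM2 : (M : ℝ) ≤ a ^ 2 * c / b ^ 2 + 1 := (Nat.ceil_lt_add_one (by positivity)).le
  obtain ⟨E, hEN, hEM, hEτ⟩ :=
    MLSD.exists_exploration (n := n) (k := k) (τmax := τmax) (L := L) hk hτ hM0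
  refine ⟨E, fun ch p hp Ω _ μ _ X hX => ?_⟩
  have hkτ : (0 : ℝ) ≤ k * τmax := by positivity
  have hQ0 : 0 < a ^ 2 * b * c := by positivity
  rcases le_or_gt (b ^ 3) (a ^ 2 * b * c) with hcase | hcase
  · have hmain := MLSD.etcRegret_le hk hτ hε0 hε1 hL1
      (by rw [← div_le_iff₀' hε0]; exact hLε) hX hp E ch hEτ hM0 hEM
      hδ0 T
    have hexplore : (k : ℝ) * E.N ≤ 6 * (a ^ 2 * b * c + b ^ 3) + k * τmax := by
      have h3 : n * D * M ≤ a ^ 2 * b * c + b ^ 3 := by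
        rw [← hb3]
        refine (mul_le_mul_of_nonneg_left hM2 (by positivity : 0 ≤ b ^ 3)).trans (le_of_eq ?_)
        field_simp
      rw [hEN]
      push_cast
      exact MLSD.exploration_cost_le hkn.le hτ (by positivity) hL2 hD h3
    have hestimate : T * (k * δ) = a ^ 2 * b * c := by
      rw [← mul_assoc, mul_comm (T : ℝ), ← ha3, hδ]
      field_simp
    have hexp : Real.exp (-(2 * M * δ ^ 2)) ≤ 1 / y ^ 2 := by
      have h1 : Real.log y ≤ M * δ ^ 2 := by
        rw [← hc3]
        calc c ^ 3 = a ^ 2 * c / b ^ 2 * δ ^ 2 := by rw [hδ]; field_simp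
          _ ≤ _ := mul_le_mul_of_nonneg_right hM1 (by positivity)
      have h2 : Real.exp (-(2 * Real.log y)) = 1 / y ^ 2 := by
        rw [Real.exp_neg, two_mul, Real.exp_add, Real.exp_log (by linarith), one_div, sq]
      rw [← h2, Real.exp_le_exp]
      linarith
    have hdeviation : T * (n * ((τmax + L) * (2 * Real.exp (-(2 * M * δ ^ 2))))) ≤ 2 * n := by
      refine MLSD.deviation_cost_le hn0.le (by linarith) (by positivity) hy2 ?_ hexp
      rw [hy, ← mul_assoc]
      exact mul_le_mul_of_nonneg_right (by linarith) (by linarith)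
    linarith
  · -- Here even the total payoff `k T = a³` of all rounds is at most `2 a² b c`.
    have h1 := MLSD.etcRegret_le_mul hX hp E ch hε0.le hε1.le T
    have h2 := MLSD.pow_three_le_of_lt ha0 hb0 hc0 (by rw [hc3]; exact hlog) hcase
    linarith
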